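/- **Setting.** Let $N\ge 1$, $d\in\{1,2,3\}$, and let $\mathcal W\in L^1_{\mathrm{loc}}(\mathbb R^{dN};\mathbb R_+)$; write $X=(x_1,\dots,x_N)\in\mathbb R^{dN}$. Let $\mathfrak h$ be a separable complex Hilbert space, $\omega\ge 0$ an injective self-adjoint (possibly unbounded) operator on $\mathfrak h$, and let $\mathfrak h_\omega$ be the completion of $\bigcap_{k}\mathscr D(\omega^k)$ for the scalar product $\langle\cdot|\omega|\cdot\rangle_{\mathfrak h}$, so that $\langle z|\omega|z\rangle=\|z\|^2_{\mathfrak h_\omega}$. If $f\in\mathscr D(\omega^{-1/2})$, then $z\mapsto\langle z|f\rangle_{\mathfrak h}$ extends by continuity to $\mathfrak h_\omega$. Consider one of the following energy functionals $\mathcal E_{\mathrm{qc}}[\psi,z]=\langle\psi|\mathcal H_z|\psi\rangle_{L^2(\mathbb R^{dN})}$, understood as a quadratic form on $\psi\in H^1(\mathbb R^{dN})$, $\int\mathcal W|\psi|^2<\infty$, and equal to $+\infty$ for all other $\psi\in L^2(\mathbb R^{dN})$, where $z\in\mathfrak h_\omega$: (a) *Nelson model*: $\mathcal H_z=\sum_{j}\big(-\Delta_j+2\,\mathrm{Re}\langle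 z|\lambda(x_j)\rangle_{\mathfrak h}\big)+\mathcal W+\langle z|\omega|z\rangle$ with $\lambda,\ \omega^{-1/2}\lambda\in L^\infty(\mathbb R^d;\mathfrak h)$. (b) *Polaron*: $\mathfrak h=\mathfrak h_\omega=L^2(\mathbb R^d)$, $\omega=1$, and $\mathcal H_z=\sum_j\big(-\Delta_j+\mathcal V_z(x_j)\big)+\mathcal W+\|z\|^2$ with formally $\mathcal V_z(x)=2\,\mathrm{Re}\langle z|\lambda(x)\rangle$, $\lambda(x;k)=\sqrt\alpha\,e^{-ik\cdot x}|k|^{-(d-1)/2}$, $\alpha>0$. This means $\mathcal V_z=\mathcal V_{<,z}+\nabla\cdot\mathbf b_z$ for a cut-off $\varrho>0$, where $$\mathcal V_{<,z}(x)=2\,\mathrm{Re}\int_{|k|\le\varrho}\overline{z(k)}\,\sqrt\alpha\,|k|^{-\frac{d-1}2}e^{-ik\cdot x}\,dk,\qquad \mathbf b_z(x)=-2\,\mathrm{Im}\int_{|k|>\varrho}\overline{z(k)}\,\sqrt\alpha\,|k|^{-\frac{d+1}2}\tfrac{k}{|k|}e^{-ik\cdot x}\,dk,$$ and $\langle\psi|(\nabla\cdot\mathbf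 b_z)(x_j)|\psi\rangle:=-2\,\mathrm{Re}\int\mathbf b_z(x_j)\cdot\overline{\psi}\,\nabla_j\psi\,dX$. (c) *Pauli–Fierz model* ($d=3$): $\mathcal H_z=\sum_j\frac1{2m_j}\big(-i\nabla_j+e\,\mathbf a_{z,j}(x_j)\big)^2+\mathcal W+\langle z|\omega|z\rangle$, $\mathbf a_{z,j}(x)=2\,\mathrm{Re}\langle z|\boldsymbol\lambda_j(x)\rangle_{\mathfrak h}$, with $m_j>0$, $e\in\mathbb R$, $\lambda_{j,\ell},\ \omega^{\pm1/2}\lambda_{j,\ell}\in L^\infty(\mathbb R^3;\mathfrak h)$ for $\ell=1,2,3$, and $\nabla\cdot\boldsymbol\lambda_j=0$ in the sense of distributions. **Variational problems.** All infima are taken in $[-\infty,+\infty]$. * $E_{\mathrm{qc}}=\inf\{\mathcal E_{\mathrm{qc}}[\psi,z]:\ \|\psi\|_2=1,\ z\in\mathfrak h_\omega,\ |\mathcal E_{\mathrm{qc}}[\psi,z]|<\infty\}$. * A state-valued probability measure is a Borel measure $\mathfrak m$ on $\mathfrak h_\omega$ with values in the positive trace class operators on $L^2(\mathbb R^{dN})$,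 countably additive in trace norm, with $\mathrm{tr}\,\mathfrak m(\mathfrak h_\omega)=1$. Let $\mu_{\mathfrak m}(S)=\mathrm{tr}\,\mathfrak m(S)$ and let $\gamma_{\mathfrak m}$, with values in the density matrices of trace one, be its Radon–Nikodym derivative: $d\mathfrak m=\gamma_{\mathfrak m}\,d\mu_{\mathfrak m}$. Then $\mathcal E_{\mathrm{svm}}[\mathfrak m]=\int d\mu_{\mathfrak m}(z)\,\mathrm{tr}[\gamma_{\mathfrak m}(z)\mathcal H_z]$, where $\mathrm{tr}[\gamma\mathcal H_z]=\sum_kp_k\,\mathcal E_{\mathrm{qc}}[\psi_k,z]$ if $\gamma=\sum_kp_k|\psi_k\rangle\langle\psi_k|$ with $p_k\ge0$ and $(\psi_k)$ orthonormal, and $E_{\mathrm{svm}}$ is the infimum of $\mathcal E_{\mathrm{svm}}[\mathfrak m]$ over all $\mathfrak m$ with $|\mathcal E_{\mathrm{svm}}[\mathfrak m]|<\infty$. Let $E_{\mathrm{svm}}^{\mathrm{atom}}$ be the infimum over those $\mathfrak m$ that are moreover supported on finitely many points. * $E_{\mathrm{pm}}$ is the infimum of $\mathcal E_{\mathrm{pm}}[\psi,\mu]=\int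 d\mu(z)\,\mathcal E_{\mathrm{qc}}[\psi,z]$ over $\|\psi\|_2=1$ and Borel probability measures $\mu$ on $\mathfrak h_\omega$ with $|\mathcal E_{\mathrm{pm}}[\psi,\mu]|<\infty$, and $E_{\mathrm{pm}}^{\mathrm{atom}}$ is the same infimum restricted to $\mu$ supported on finitely many points. * $E_{\mathrm{Pekar}}=\inf\{\mathcal E_{\mathrm{Pekar}}[\psi]:\ \|\psi\|_2=1,\ |\mathcal E_{\mathrm{Pekar}}[\psi]|<\infty\}$, where $\mathcal E_{\mathrm{Pekar}}[\psi]=\inf_{z\in\mathfrak h_\omega}\mathcal E_{\mathrm{qc}}[\psi,z]$; and $E_{\mathrm{Pekar}}^{\mathrm{impl}}$ is the same infimum for the Pekar functional in its implicit form, $\psi\mapsto\mathcal E_{\mathrm{qc}}[\psi,z_\psi]$, where $z_\psi\in\mathfrak h_\omega$ is the critical point of $z\mapsto\mathcal E_{\mathrm{qc}}[\psi,z]$, i.e. $\frac{d}{dt}\mathcal E_{\mathrm{qc}}[\psi,z_\psi+t\zeta]\big|_{t=0}=0$ for all $\zeta\in\mathfrak h_\omega$. * $\mathcal I[z]=\inf_{\|\psi\|_2=1}\mathcal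 E_{\mathrm{qc}}[\psi,z]$ for $z\in\mathfrak h_\omega$. **Proposition (Quasi-classical energies).** In each of the three models, $$E_{\mathrm{qc}}=E_{\mathrm{svm}}=E_{\mathrm{svm}}^{\mathrm{atom}}=E_{\mathrm{pm}}=E_{\mathrm{pm}}^{\mathrm{atom}}=E_{\mathrm{Pekar}}=E_{\mathrm{Pekar}}^{\mathrm{impl}}=\inf_{z\in\mathfrak h_\omega}\mathcal I[z].$$ -/

import Mathlib

noncomputable section

namespace QuasiClassical

open MeasureTheory Filter Topology
open scoped ENNReal InnerProductSpace

/-! ### Extended integrals, trace norm, traces -/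

/-- An extended real number is finite. -/
def IsFinite (x : EReal) : Prop := x ≠ ⊤ ∧ x ≠ ⊥

/-- The integral of an extended real function, i.e. the integral of its positive part minus the
integral of its negative part. -/
def extIntegral {Z : Type*} [MeasurableSpace Z] (μ : Measure Z) (f : Z → EReal) : EReal :=
  ((∫⁻ z, (f z).toENNReal ∂μ : ℝ≥0∞) : EReal) - ((∫⁻ z, (-f z).toENNReal ∂μ : ℝ≥0∞) : EReal)

section Operators

variable {H : Type*} [NormedAddCommGroup H] [InnerProductSpace ℂ H]

/-- The trace norm of a bounded operator, in its variational form
`sup |∑ ⟨uᵢ, A vᵢ⟩|` over finite orthonormal families; it is `⊤` iff `A` is not trace class, and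
it is the trace of `A` if `A ≥ 0`. -/
def traceNorm (A : H →L[ℂ] H) : ℝ≥0∞ :=
  ⨆ (n : ℕ) (u : Fin n → H) (v : Fin n → H) (_ : Orthonormal ℂ u) (_ : Orthonormal ℂ v),
    ‖∑ i, ⟪u i, A (v i)⟫_ℂ‖ₑ

/-- Normalized density matrices: positive trace class operators of trace one. -/
def IsDensityMatrix [CompleteSpace H] (γ : H →L[ℂ] H) : Prop :=
  γ.IsPositive ∧ traceNorm γ = 1

/-- `γ = ∑ₖ pₖ |ψₖ⟩⟨ψₖ|` with `pₖ ≥ 0` and `ψₖ` orthonormal. -/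
structure IsSpectralDecomposition (γ : H →L[ℂ] H) (p : ℕ → ℝ) (ψ : ℕ → H) : Prop where
  nonneg : ∀ k, 0 ≤ p k
  orthonormal : Orthonormal ℂ ψ
  hasSum : ∀ φ : H, HasSum (fun k => ((p k : ℂ) * ⟪ψ k, φ⟫_ℂ) • ψ k) (γ φ)

/-- `tr[γ Q] = ∑ₖ pₖ Q[ψₖ]` for a density matrix `γ = ∑ₖ pₖ |ψₖ⟩⟨ψₖ|` and a quadratic form `Q`,
with the value `⊤` off its form domain. The value does not depend on the spectral decomposition
of `γ`, so that the infimum is over a single value. -/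
def traceForm (Q : H → EReal) (γ : H →L[ℂ] H) : EReal :=
  ⨅ (p : ℕ → ℝ) (ψ : ℕ → H) (_ : IsSpectralDecomposition γ p ψ),
    extIntegral Measure.count (fun k => (p k : EReal) * Q (ψ k))

end Operators

/-! ### State-valued probability measures -/

/-- A probability measure on `Z` with values in the positive trace class operators on `H`,
countably additive in trace norm. -/
structure StateValuedMeasure (Z : Type*) [MeasurableSpace Z]
    (H : Type*) [NormedAddCommGroup H] [InnerProductSpace ℂ H] [CompleteSpace H] where
  /-- The value of the measure on a (measurable) set. -/
  toFun : Set Z → (H →L[ℂ] H)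
  isPositive : ∀ S, MeasurableSet S → (toFun S).IsPositive
  traceClass : ∀ S, MeasurableSet S → traceNorm (toFun S) < ⊤
  empty : toFun ∅ = 0
  iUnion : ∀ S : ℕ → Set Z, (∀ n, MeasurableSet (S n)) → Pairwise (Function.onFun Disjoint S) →
    Tendsto (fun n => traceNorm (toFun (⋃ i, S i) - ∑ i ∈ Finset.range n, toFun (S i)))
      atTop (𝓝 0)
  norm_univ : traceNorm (toFun Set.univ) = 1

section Functionals

variable {Z : Type*} [MeasurableSpace Z]
variable {H : Type*} [NormedAddCommGroup H] [InnerProductSpace ℂ H] [CompleteSpace H]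

/-- `μ` is the norm measure of `𝔪` and `γ`, with values in the normalized density matrices, is the
Radon–Nikodym derivative of `𝔪` with respect to `μ`: `d𝔪(z) = γ(z) dμ(z)`. -/
structure IsRadonNikodym (𝔪 : StateValuedMeasure Z H) (μ : Measure Z) (γ : Z → (H →L[ℂ] H)) :
    Prop where
  norm_measure : ∀ S, MeasurableSet S → μ S = traceNorm (𝔪.toFun S)
  measurable : ∀ φ χ : H, Measurable fun z => ⟪φ, γ z χ⟫_ℂ
  density : ∀ᵐ z ∂μ, IsDensityMatrix (γ z)
  integral_eq : ∀ S, MeasurableSet S → ∀ φ χ : H,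
    ⟪φ, 𝔪.toFun S χ⟫_ℂ = ∫ z in S, ⟪φ, γ z χ⟫_ℂ ∂μ

/-- A scalar measure supported on finitely many points. (An infimum over these that agrees with the
one over all measures also agrees with the one over countably supported measures.) -/
def IsAtomic (μ : Measure Z) : Prop := ∃ F : Finset Z, μ (F : Set Z)ᶜ = 0

/-- A state-valued measure supported on finitely many points. -/
def StateValuedMeasure.IsAtomic (𝔪 : StateValuedMeasure Z H) : Prop :=
  ∃ F : Finset Z, 𝔪.toFun (F : Set Z)ᶜ = 0

/-! ### The variational problems

`𝓔 ψ z` is an energy functional of a wave function `ψ` and a classical field `z`, the value of the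
quadratic form of the quasi-classical Hamiltonian at `z` on `ψ`, equal to `⊤` off the form domain. -/

/-- `E_qc`. -/
def qcEnergy (𝓔 : H → Z → EReal) : EReal :=
  ⨅ (ψ : H) (z : Z) (_ : ‖ψ‖ = 1) (_ : IsFinite (𝓔 ψ z)), 𝓔 ψ z

/-- `𝓔_svm[𝔪] = ∫ dμ_𝔪(z) tr[γ_𝔪(z) 𝓗_z]`. The pair `(μ_𝔪, γ_𝔪)` is unique up to null sets, so
that the infimum is over a single value. -/
def svmFunctional (𝓔 : H → Z → EReal) (𝔪 : StateValuedMeasure Z H) : EReal :=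
  ⨅ (μ : Measure Z) (γ : Z → (H →L[ℂ] H)) (_ : IsRadonNikodym 𝔪 μ γ),
    extIntegral μ (fun z => traceForm (fun ψ => 𝓔 ψ z) (γ z))

/-- `E_svm`. -/
def svmEnergy (𝓔 : H → Z → EReal) : EReal :=
  ⨅ (𝔪 : StateValuedMeasure Z H) (_ : IsFinite (svmFunctional 𝓔 𝔪)), svmFunctional 𝓔 𝔪

/-- The infimum of `𝓔_svm` over atomic state-valued measures. -/
def svmAtomicEnergy (𝓔 : H → Z → EReal) : EReal :=
  ⨅ (𝔪 : StateValuedMeasure Z H) (_ : 𝔪.IsAtomic) (_ : IsFinite (svmFunctional 𝓔 𝔪)),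
    svmFunctional 𝓔 𝔪

/-- `𝓔_pm[ψ, μ] = ∫ dμ(z) ⟨ψ|𝓗_z|ψ⟩`. -/
def pmFunctional (𝓔 : H → Z → EReal) (ψ : H) (μ : Measure Z) : EReal :=
  extIntegral μ (fun z => 𝓔 ψ z)

/-- `E_pm`. -/
def pmEnergy (𝓔 : H → Z → EReal) : EReal :=
  ⨅ (ψ : H) (μ : Measure Z) (_ : ‖ψ‖ = 1) (_ : IsProbabilityMeasure μ)
    (_ : IsFinite (pmFunctional 𝓔 ψ μ)), pmFunctional 𝓔 ψ μ

/-- The infimum of `𝓔_pm` over atomic measures. -/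
def pmAtomicEnergy (𝓔 : H → Z → EReal) : EReal :=
  ⨅ (ψ : H) (μ : Measure Z) (_ : ‖ψ‖ = 1) (_ : IsProbabilityMeasure μ) (_ : IsAtomic μ)
    (_ : IsFinite (pmFunctional 𝓔 ψ μ)), pmFunctional 𝓔 ψ μ

/-- `E_F`, the infimum of a functional `F[ψ]` over normalized `ψ` of finite energy. -/
def waveEnergy (F : H → EReal) : EReal :=
  ⨅ (ψ : H) (_ : ‖ψ‖ = 1) (_ : IsFinite (F ψ)), F ψ

/-- The Pekar functional `𝓔_Pekar[ψ] = inf_z 𝓔[ψ, z]`. -/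
def pekarFunctional (𝓔 : H → Z → EReal) (ψ : H) : EReal := ⨅ z : Z, 𝓔 ψ z

/-- `z` solves the Euler–Lagrange equation `δ_z 𝓔[ψ, z] = 0` at fixed `ψ`. -/
def IsCriticalField [AddCommGroup Z] [Module ℂ Z] (𝓔 : H → Z → EReal) (ψ : H) (z : Z) : Prop :=
  ∀ ζ : Z, HasDerivAt (fun t : ℝ => (𝓔 ψ (z + (t : ℂ) • ζ)).toReal) 0 0

/-- The Pekar functional in its implicit form: `𝓔_Pekar[ψ] = 𝓔[ψ, z_ψ]`, where `z_ψ` is the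
solution of `δ_z 𝓔[ψ, z] = 0` (and `⊤` if there is none). -/
def pekarImplicitFunctional [AddCommGroup Z] [Module ℂ Z] (𝓔 : H → Z → EReal) (ψ : H) : EReal :=
  ⨅ (z : Z) (_ : IsCriticalField 𝓔 ψ z), 𝓔 ψ z

/-- `𝓘[z] = inf_ψ 𝓔[ψ, z]` over normalized `ψ`. -/
def fieldFunctional (𝓔 : H → Z → EReal) (z : Z) : EReal := ⨅ (ψ : H) (_ : ‖ψ‖ = 1), 𝓔 ψ z

/-- All the ground state energies attached to `𝓔` coincide, as extended real numbers. -/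
def EnergiesCoincide [AddCommGroup Z] [Module ℂ Z] (𝓔 : H → Z → EReal) : Prop :=
  qcEnergy 𝓔 = svmEnergy 𝓔 ∧
  svmEnergy 𝓔 = svmAtomicEnergy 𝓔 ∧
  svmAtomicEnergy 𝓔 = pmEnergy 𝓔 ∧
  pmEnergy 𝓔 = pmAtomicEnergy 𝓔 ∧
  pmAtomicEnergy 𝓔 = waveEnergy (pekarFunctional 𝓔) ∧
  waveEnergy (pekarFunctional 𝓔) = waveEnergy (pekarImplicitFunctional 𝓔) ∧
  waveEnergy (pekarImplicitFunctional 𝓔) = ⨅ z : Z, fieldFunctional 𝓔 z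

end Functionals

/-! ### The particles -/

/-- `ℝ^d`. -/
abbrev Space (d : ℕ) := EuclideanSpace ℝ (Fin d)

/-- `ℝ^{dN}`, the configuration space of `N` particles in `ℝ^d`. -/
abbrev Config (d N : ℕ) := EuclideanSpace ℝ (Fin N × Fin d)

/-- `L²(ℝ^{dN})`. -/
abbrev ParticleSpace (d N : ℕ) := Lp ℂ 2 (volume : Measure (Config d N))

/-- The position `x_j ∈ ℝ^d` of the `j`-th particle in the configuration `X = (x_1, …, x_N)`. -/
def position {d N : ℕ} (j : Fin N) (X : Config d N) : Space d :=
  WithLp.toLp 2 fun l => X (j, l)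

/-- `G` is the weak gradient of `ψ`, with components in `L²`. -/
def IsWeakGradient {d N : ℕ} (ψ : ParticleSpace d N) (G : Fin N × Fin d → ParticleSpace d N) :
    Prop :=
  ∀ (a : Fin N × Fin d) (φ : Config d N → ℝ), ContDiff ℝ ((⊤ : ℕ∞) : WithTop ℕ∞) φ →
    HasCompactSupport φ →
    ∫ X, ψ X * (fderiv ℝ φ X (EuclideanSpace.single a 1) : ℂ) = - ∫ X, G a X * (φ X : ℂ)

/-- `ψ ∈ H¹(ℝ^{dN})`. -/
def MemH1 {d N : ℕ} (ψ : ParticleSpace d N) : Prop := ∃ G, IsWeakGradient ψ G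

open Classical in
/-- The weak gradient of `ψ ∈ H¹(ℝ^{dN})`. -/
def weakGrad {d N : ℕ} (ψ : ParticleSpace d N) : Fin N × Fin d → ParticleSpace d N :=
  if h : MemH1 ψ then h.choose else 0

/-- A nonnegative locally integrable potential `𝓦` on `ℝ^{dN}`. -/
structure Potential (d N : ℕ) where
  /-- The potential. -/
  W : Config d N → ℝ
  locallyIntegrable : LocallyIntegrable W volume
  nonneg : ∀ᵐ X, 0 ≤ W X

/-- The form domain of `-Δ + 𝓦`. -/
def Potential.FormDomain {d N : ℕ} (V : Potential d N) (ψ : ParticleSpace d N) : Prop :=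
  MemH1 ψ ∧ Integrable (fun X => V.W X * ‖ψ X‖ ^ 2)

/-- `⟨ψ|𝓦|ψ⟩`. -/
def Potential.energy {d N : ℕ} (V : Potential d N) (ψ : ParticleSpace d N) : ℝ :=
  ∫ X, V.W X * ‖ψ X‖ ^ 2

/-! ### The classical field -/

section Field

variable {𝔥 : Type*} [NormedAddCommGroup 𝔥] [InnerProductSpace ℂ 𝔥] [CompleteSpace 𝔥]

/-- A nonnegative self-adjoint, possibly unbounded, injective operator `ω` on `𝔥`. -/
structure Dispersion (𝔥 : Type*) [NormedAddCommGroup 𝔥] [InnerProductSpace ℂ 𝔥]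
    [CompleteSpace 𝔥] where
  /-- The operator. -/
  op : 𝔥 →ₗ.[ℂ] 𝔥
  selfAdjoint : IsSelfAdjoint op
  nonneg : ∀ u : op.domain, 0 ≤ (⟪(u : 𝔥), op u⟫_ℂ).re
  injective : ∀ u : op.domain, op u = 0 → (u : 𝔥) = 0

/-- `S` is the nonnegative self-adjoint square root `ω^{1/2}` of `ω`. -/
structure IsSqrt (S : 𝔥 →ₗ.[ℂ] 𝔥) (ω : Dispersion 𝔥) : Prop where
  selfAdjoint : IsSelfAdjoint S
  nonneg : ∀ u : S.domain, 0 ≤ (⟪(u : 𝔥), S u⟫_ℂ).re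
  sq : ∀ u w : 𝔥, (u, w) ∈ ω.op.graph ↔ ∃ v, (u, v) ∈ S.graph ∧ (v, w) ∈ S.graph

/-- `ω^{1/2} f ∈ L^∞(ℝ^d; 𝔥)`. -/
def SqrtBounded {d : ℕ} (ω : Dispersion 𝔥) (f : Space d → 𝔥) : Prop :=
  ∃ (S : 𝔥 →ₗ.[ℂ] 𝔥) (g : Space d → 𝔥), IsSqrt S ω ∧ MemLp g ⊤ volume ∧
    ∀ᵐ x, (f x, g x) ∈ S.graph

/-- `ω^{-1/2} f ∈ L^∞(ℝ^d; 𝔥)`. -/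
def InvSqrtBounded {d : ℕ} (ω : Dispersion 𝔥) (f : Space d → 𝔥) : Prop :=
  ∃ (S : 𝔥 →ₗ.[ℂ] 𝔥) (g : Space d → 𝔥), IsSqrt S ω ∧ MemLp g ⊤ volume ∧
    ∀ᵐ x, (g x, f x) ∈ S.graph

/-- The domain of `ω^k`. -/
def Dispersion.powDomain (ω : Dispersion 𝔥) : ℕ → Submodule ℂ 𝔥
  | 0 => ⊤
  | k + 1 => ((ω.powDomain k).comap ω.op.toFun).map ω.op.domain.subtype

theorem Dispersion.mem_domain (ω : Dispersion 𝔥) {u : 𝔥} (hu : u ∈ ⨅ k, ω.powDomain k) :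
    u ∈ ω.op.domain := by
  have h := (Submodule.mem_iInf _).1 hu 1
  obtain ⟨v, -, rfl⟩ := h
  exact v.2

/-- The space `⋂ₖ 𝓓(ω^k)`, to be endowed with the scalar product `⟨u|ω|v⟩`. -/
def Dispersion.Smooth (ω : Dispersion 𝔥) : Type _ := ↥(⨅ k, ω.powDomain k)

instance (ω : Dispersion 𝔥) : AddCommGroup ω.Smooth :=
  inferInstanceAs (AddCommGroup ↥(⨅ k, ω.powDomain k))

instance (ω : Dispersion 𝔥) : Module ℂ ω.Smooth :=
  inferInstanceAs (Module ℂ ↥(⨅ k, ω.powDomain k))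

/-- The inclusion of `⋂ₖ 𝓓(ω^k)` into `𝓓(ω)`. -/
def Dispersion.toDomain (ω : Dispersion 𝔥) : ω.Smooth →ₗ[ℂ] ω.op.domain :=
  Submodule.inclusion (p := ⨅ k, ω.powDomain k) fun _ hu => ω.mem_domain hu

theorem Dispersion.symmetric (ω : Dispersion 𝔥) (u v : ω.op.domain) :
    ⟪ω.op u, (v : 𝔥)⟫_ℂ = ⟪(u : 𝔥), ω.op v⟫_ℂ := by
  have h := LinearPMap.adjoint_isFormalAdjoint (T := ω.op) ω.selfAdjoint.dense_domain
  rw [LinearPMap.isSelfAdjoint_def.1 ω.selfAdjoint] at h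
  exact h u v

/-- The scalar product `⟨u|ω|v⟩` on `⋂ₖ 𝓓(ω^k)`. -/
@[reducible]
def Dispersion.core (ω : Dispersion 𝔥) : PreInnerProductSpace.Core ℂ ω.Smooth where
  inner u v := ⟪(ω.toDomain u : 𝔥), ω.op (ω.toDomain v)⟫_ℂ
  conj_inner_symm u v := by
    rw [inner_conj_symm, ω.symmetric]
  re_inner_nonneg u := ω.nonneg _
  add_left u v w := by simp
  smul_left u v r := by simp [mul_comm]

instance (ω : Dispersion 𝔥) : SeminormedAddCommGroup ω.Smooth :=
  @InnerProductSpace.Core.toSeminormedAddCommGroup ℂ ω.Smooth _ _ _ ω.core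

instance (ω : Dispersion 𝔥) : InnerProductSpace ℂ ω.Smooth := InnerProductSpace.ofCore ω.core

/-- The Hilbert space `𝔥_ω`, the completion of `⋂ₖ 𝓓(ω^k)` for `⟨·|ω|·⟩`. -/
abbrev Dispersion.FieldSpace (ω : Dispersion 𝔥) : Type _ := UniformSpace.Completion ω.Smooth

instance (ω : Dispersion 𝔥) : MeasurableSpace ω.FieldSpace := borel _

instance (ω : Dispersion 𝔥) : BorelSpace ω.FieldSpace := ⟨rfl⟩

/-- `⟨z|f⟩` for `z ∈ 𝔥_ω` and `f ∈ 𝓓(ω^{-1/2})`: the extension by continuity of the scalar product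
of `𝔥` from `⋂ₖ 𝓓(ω^k)` to `𝔥_ω`. -/
def Dispersion.pairing (ω : Dispersion 𝔥) (z : ω.FieldSpace) (f : 𝔥) : ℂ :=
  UniformSpace.Completion.extension (fun u : ω.Smooth => ⟪(ω.toDomain u : 𝔥), f⟫_ℂ) z

end Field

/-! ### The Nelson model -/

/-- The data of the Nelson model. -/
structure NelsonModel (𝔥 : Type*) [NormedAddCommGroup 𝔥] [InnerProductSpace ℂ 𝔥]
    [CompleteSpace 𝔥] (d N : ℕ) where
  /-- The external potential and the interaction of the particles. -/
  potential : Potential d N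
  /-- The dispersion relation of the field. -/
  ω : Dispersion 𝔥
  /-- The form factor `x ↦ λ(x)`. -/
  lam : Space d → 𝔥
  memLp : MemLp lam ⊤ volume
  invSqrt : InvSqrtBounded ω lam

open Classical in
/-- `𝓔_qc[ψ, z] = ⟨ψ| ∑ⱼ (-Δⱼ + 2 Re ⟨z|λ(xⱼ)⟩) + 𝓦 + ⟨z|ω|z⟩ |ψ⟩`. -/
def NelsonModel.energy {𝔥 : Type*} [NormedAddCommGroup 𝔥] [InnerProductSpace ℂ 𝔥]
    [CompleteSpace 𝔥] {d N : ℕ} (M : NelsonModel 𝔥 d N)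
    (ψ : ParticleSpace d N) (z : M.ω.FieldSpace) : EReal :=
  if M.potential.FormDomain ψ then
    (((∑ a, ‖weakGrad ψ a‖ ^ 2) + M.potential.energy ψ
      + (∑ j, ∫ X, 2 * (M.ω.pairing z (M.lam (position j X))).re * ‖ψ X‖ ^ 2)
      + ‖z‖ ^ 2 * ‖ψ‖ ^ 2 : ℝ) : EReal)
  else ⊤

/-! ### The polaron model -/

/-- The field space `L²(ℝ^d)` of the polaron (where `ω = 1`). -/
abbrev PolaronField (d : ℕ) := Lp ℂ 2 (volume : Measure (Space d))

instance (d : ℕ) : MeasurableSpace (PolaronField d) := borel _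

instance (d : ℕ) : BorelSpace (PolaronField d) := ⟨rfl⟩

/-- The data of the polaron model: the potential, the coupling constant `α`, and the cut-off `ϱ`
used to give a meaning to the singular potential `𝓥_z`. -/
structure PolaronModel (d N : ℕ) where
  /-- The external potential and the interaction of the particles. -/
  potential : Potential d N
  /-- The coupling constant. -/
  α : ℝ
  α_pos : 0 < α
  /-- The momentum cut-off. -/
  ϱ : ℝ
  ϱ_pos : 0 < ϱ

namespace PolaronModel

variable {d N : ℕ} (M : PolaronModel d N)

/-- The low momentum part
`𝓥_{<,z}(x) = 2 Re ∫_{|k| ≤ ϱ} conj z(k) √α |k|^{-(d-1)/2} e^{-ik·x} dk` of the potential. -/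
def lowPotential (z : PolaronField d) (x : Space d) : ℝ :=
  2 * (∫ k in {k : Space d | ‖k‖ ≤ M.ϱ}, (starRingEnd ℂ) (z k) *
    ((Real.sqrt M.α * ‖k‖ ^ (-((d : ℝ) - 1) / 2) : ℝ) : ℂ) *
      Complex.exp (-(Complex.I * (⟪k, x⟫_ℝ : ℂ)))).re

/-- The components of the bounded vector field
`𝐛_z(x) = -2 Im ∫_{|k| > ϱ} conj z(k) √α |k|^{-(d+1)/2} (k/|k|) e^{-ik·x} dk`, whose divergence
is the high momentum part `2 Re ∫_{|k| > ϱ} conj z(k) √α |k|^{-(d-1)/2} e^{-ik·x} dk` of the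
potential. -/
def highField (z : PolaronField d) (l : Fin d) (x : Space d) : ℝ :=
  -2 * (∫ k in {k : Space d | M.ϱ < ‖k‖}, (starRingEnd ℂ) (z k) *
    ((Real.sqrt M.α * ‖k‖ ^ (-((d : ℝ) + 1) / 2) * (k l / ‖k‖) : ℝ) : ℂ) *
      Complex.exp (-(Complex.I * (⟪k, x⟫_ℝ : ℂ)))).im

open Classical in
/-- `𝓔_qc[ψ, z] = ⟨ψ| ∑ⱼ (-Δⱼ + 𝓥_z(xⱼ)) + 𝓦 + ‖z‖² |ψ⟩` with `𝓥_z = 𝓥_{<,z} + div 𝐛_z`, where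
`⟨ψ|(div 𝐛_z)(xⱼ)|ψ⟩ = -2 Re ∫ 𝐛_z(xⱼ) · conj ψ ∇ⱼψ`. -/
def energy (ψ : ParticleSpace d N) (z : PolaronField d) : EReal :=
  if M.potential.FormDomain ψ then
    (((∑ a, ‖weakGrad ψ a‖ ^ 2) + M.potential.energy ψ
      + (∑ j, ((∫ X, M.lowPotential z (position j X) * ‖ψ X‖ ^ 2)
        - 2 * ∑ l, ∫ X, M.highField z l (position j X) *
            ((starRingEnd ℂ) (ψ X) * weakGrad ψ (j, l) X).re))
      + ‖z‖ ^ 2 * ‖ψ‖ ^ 2 : ℝ) : EReal)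
  else ⊤

end PolaronModel

/-! ### The Pauli–Fierz model -/

/-- The data of the Pauli–Fierz model (in three dimensions). -/
structure PauliFierzModel (𝔥 : Type*) [NormedAddCommGroup 𝔥] [InnerProductSpace ℂ 𝔥]
    [CompleteSpace 𝔥] (N : ℕ) where
  /-- The external potential and the interaction of the particles. -/
  potential : Potential 3 N
  /-- The dispersion relation of the field. -/
  ω : Dispersion 𝔥
  /-- The masses of the particles. -/
  mass : Fin N → ℝ
  mass_pos : ∀ j, 0 < mass j
  /-- The charge. -/
  e : ℝ
  /-- The form factors `x ↦ λ_{j,l}(x)`. -/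
  lam : Fin N → Fin 3 → Space 3 → 𝔥
  memLp : ∀ j l, MemLp (lam j l) ⊤ volume
  sqrt : ∀ j l, SqrtBounded ω (lam j l)
  invSqrt : ∀ j l, InvSqrtBounded ω (lam j l)
  /-- Coulomb gauge, `∇ · 𝛌_j = 0` in the sense of distributions. -/
  coulomb : ∀ (j : Fin N) (φ : Space 3 → ℝ), ContDiff ℝ ((⊤ : ℕ∞) : WithTop ℕ∞) φ →
    HasCompactSupport φ →
    ∑ l, ∫ x, ((fderiv ℝ φ x (EuclideanSpace.single l 1) : ℝ) : ℂ) • lam j l x = 0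

namespace PauliFierzModel

variable {𝔥 : Type*} [NormedAddCommGroup 𝔥] [InnerProductSpace ℂ 𝔥] [CompleteSpace 𝔥] {N : ℕ}
  (M : PauliFierzModel 𝔥 N)

/-- The components of the classical field `𝐚_{z,j}(x) = 2 Re ⟨z|𝛌_j(x)⟩`. -/
def vectorPotential (z : M.ω.FieldSpace) (j : Fin N) (l : Fin 3) (x : Space 3) : ℝ :=
  2 * (M.ω.pairing z (M.lam j l x)).re

open Classical in
/-- `𝓔_qc[ψ, z] = ⟨ψ| ∑ⱼ (2mⱼ)⁻¹ (-i∇ⱼ + e 𝐚_{z,j}(xⱼ))² + 𝓦 + ⟨z|ω|z⟩ |ψ⟩`. -/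
def energy (ψ : ParticleSpace 3 N) (z : M.ω.FieldSpace) : EReal :=
  if M.potential.FormDomain ψ then
    (((∑ j, (1 / (2 * M.mass j)) * ∑ l, ∫ X, ‖-Complex.I * weakGrad ψ (j, l) X
          + ((M.e * M.vectorPotential z j l (position j X) : ℝ) : ℂ) * ψ X‖ ^ 2)
      + M.potential.energy ψ + ‖z‖ ^ 2 * ‖ψ‖ ^ 2 : ℝ) : EReal)
  else ⊤

end PauliFierzModel

end QuasiClassical

end

/-!
Every one of the variational problems is squeezed between `E_qc` and itself. The energy of a
state-valued measure, of a probability measure, or of a density matrix is an average of values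
`𝓔[ψ, z]`, hence at least `E_qc`; conversely, the Dirac masses `|ψ⟩⟨ψ| δ_z` and `δ_z` reproduce the
value `𝓔[ψ, z]` itself. In the implicit Pekar problem one uses that, for fixed normalized `ψ` in the
form domain, `z ↦ 𝓔[ψ, z]` is a continuous convex quadratic polynomial plus `‖z‖²`: by the
Lax–Milgram theorem it has a critical point, which by convexity is its minimizer. The form factors
enter only through the bounds `|a_z(x)| ≤ C ‖z‖` that make these polynomials continuous.
-/

noncomputable section

namespace QuasiClassical

open MeasureTheory Filter Topology
open scoped ENNReal InnerProductSpace

section ExtIntegral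

variable {Z : Type*} [MeasurableSpace Z]

theorem toENNReal_sub_toENNReal_neg (x : EReal) :
    ((x.toENNReal : ℝ≥0∞) : EReal) - (((-x).toENNReal : ℝ≥0∞) : EReal) = x := by
  rcases le_total 0 x with h | h
  · rw [EReal.coe_toENNReal h, EReal.toENNReal_of_nonpos (EReal.neg_le_zero.2 h),
      EReal.coe_ennreal_zero, sub_zero]
  · rw [EReal.toENNReal_of_nonpos h, EReal.coe_toENNReal (EReal.neg_nonneg.2 h),
      EReal.coe_ennreal_zero, zero_sub, neg_neg]

theorem extIntegral_mono {μ : Measure Z} {f g : Z → EReal} (h : ∀ᵐ z ∂μ, f z ≤ g z) :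
    extIntegral μ f ≤ extIntegral μ g := by
  refine EReal.sub_le_sub ?_ ?_ <;>
    refine EReal.coe_ennreal_le_coe_ennreal_iff.2 (lintegral_mono_ae (h.mono fun z hz => ?_))
  · exact EReal.toENNReal_le_toENNReal hz
  · exact EReal.toENNReal_le_toENNReal (EReal.neg_le_neg_iff.2 hz)

theorem extIntegral_const (μ : Measure Z) [IsProbabilityMeasure μ] (c : EReal) :
    extIntegral μ (fun _ => c) = c := by
  simp [extIntegral, toENNReal_sub_toENNReal_neg]

theorem extIntegral_dirac [MeasurableSingletonClass Z] (z : Z) (f : Z → EReal) :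
    extIntegral (Measure.dirac z) f = f z := by
  simp [extIntegral, toENNReal_sub_toENNReal_neg]

theorem extIntegral_count_mul_const {p : ℕ → ℝ} (hp : ∀ k, 0 ≤ p k)
    (hsum : ∑' k, ENNReal.ofReal (p k) = 1) (c : EReal) :
    extIntegral Measure.count (fun k => (p k : EReal) * c) = c := by
  have lintegral_eq (b : EReal) :
      ∫⁻ k, ((p k : EReal) * b).toENNReal ∂Measure.count = b.toENNReal := by
    simp_rw [lintegral_count, EReal.toENNReal_mul (EReal.coe_nonneg.2 (hp _)),
      EReal.toENNReal_of_ne_top (EReal.coe_ne_top _), EReal.toReal_coe]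
    rw [ENNReal.tsum_mul_right, hsum, one_mul]
  simp only [extIntegral, ← mul_neg, lintegral_eq, toENNReal_sub_toENNReal_neg]

end ExtIntegral

section Bessel

variable {𝕜 E ι : Type*} [RCLike 𝕜] [NormedAddCommGroup E] [InnerProductSpace 𝕜 E]

theorem sqrt_sum_norm_inner_sq_le {u : ι → E} (hu : Orthonormal 𝕜 u) (s : Finset ι) (x : E) :
    √(∑ i ∈ s, ‖⟪u i, x⟫_𝕜‖ ^ 2) ≤ ‖x‖ :=
  Real.sqrt_le_iff.2 ⟨norm_nonneg x, hu.sum_inner_products_le x⟩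

theorem norm_sum_inner_mul_inner_le {u v : ι → E} (hu : Orthonormal 𝕜 u) (hv : Orthonormal 𝕜 v)
    (s : Finset ι) (x y : E) : ‖∑ i ∈ s, ⟪u i, x⟫_𝕜 * ⟪y, v i⟫_𝕜‖ ≤ ‖x‖ * ‖y‖ :=
  calc ‖∑ i ∈ s, ⟪u i, x⟫_𝕜 * ⟪y, v i⟫_𝕜‖
    _ ≤ ∑ i ∈ s, ‖⟪u i, x⟫_𝕜‖ * ‖⟪v i, y⟫_𝕜‖ := norm_sum_le_of_le s fun i _ => by
        rw [norm_mul, norm_inner_symm y]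
    _ ≤ √(∑ i ∈ s, ‖⟪u i, x⟫_𝕜‖ ^ 2) * √(∑ i ∈ s, ‖⟪v i, y⟫_𝕜‖ ^ 2) :=
        Real.sum_mul_le_sqrt_mul_sqrt _ _ _
    _ ≤ ‖x‖ * ‖y‖ := by
        gcongr
        exacts [sqrt_sum_norm_inner_sq_le hu s x, sqrt_sum_norm_inner_sq_le hv s y]

theorem exists_orthonormal_seq [CompleteSpace E] (hE : ¬ FiniteDimensional 𝕜 E) {ψ : E}
    (hψ : ‖ψ‖ = 1) : ∃ e : ℕ → E, Orthonormal 𝕜 e ∧ e 0 = ψ := by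
  have orthonormal_singleton : Orthonormal 𝕜 ((↑) : ({ψ} : Set E) → E) :=
    ⟨by simpa using hψ, fun i j hij => absurd (Subsingleton.elim i j) hij⟩
  obtain ⟨w, b, hψw, hb⟩ := orthonormal_singleton.exists_hilbertBasis_extension
  have infinite_basis : Infinite w := by
    rw [← not_finite_iff_infinite]
    intro
    have := Fintype.ofFinite w
    exact hE b.toOrthonormalBasis.toBasis.finiteDimensional_of_finite
  classical
  let x : w := ⟨ψ, hψw rfl⟩
  let f : ℕ ↪ w := Infinite.natEmbedding w
  have orthonormal_basis : Orthonormal 𝕜 ((↑) : w → E) := hb ▸ b.orthonormal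
  exact ⟨fun n => Equiv.swap (f 0) x (f n),
    orthonormal_basis.comp _ ((Equiv.injective _).comp f.injective), by simp [x]⟩

end Bessel

section SpectralDecomposition

variable {H : Type*} [NormedAddCommGroup H] [InnerProductSpace ℂ H]

theorem traceNorm_zero : traceNorm (0 : H →L[ℂ] H) = 0 := by
  simp [traceNorm]

theorem tendsto_traceNorm_indicator_iUnion {Z : Type*} (γ : H →L[ℂ] H) (z : Z)
    {S : ℕ → Set Z} (hS : Pairwise (Function.onFun Disjoint S)) :
    Tendsto (fun n => traceNorm ((⋃ i, S i).indicator (fun _ => γ) z -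
      ∑ i ∈ Finset.range n, (S i).indicator (fun _ => γ) z)) atTop (𝓝 0) := by
  refine tendsto_const_nhds.congr' ?_
  by_cases hz : z ∈ ⋃ i, S i
  · obtain ⟨i, hi⟩ := Set.mem_iUnion.1 hz
    filter_upwards [eventually_gt_atTop i] with n hn
    have notMem_of_ne (j : ℕ) (hj : j ≠ i) : z ∉ S j := fun h => (hS hj).le_bot ⟨h, hi⟩
    rw [Finset.sum_eq_single_of_mem i (Finset.mem_range.2 hn) fun j _ hj =>
        Set.indicator_of_notMem (notMem_of_ne j hj) _,
      Set.indicator_of_mem hz, Set.indicator_of_mem hi, sub_self, traceNorm_zero]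
  · have hz' : ∀ i, z ∉ S i := by simpa only [Set.mem_iUnion, not_exists] using hz
    simp [hz', traceNorm_zero]

namespace IsSpectralDecomposition

variable {γ : H →L[ℂ] H} {p : ℕ → ℝ} {ψ : ℕ → H} (h : IsSpectralDecomposition γ p ψ)
include h

theorem apply_eq (k : ℕ) : γ (ψ k) = (p k : ℂ) • ψ k := by
  have hasSum_single_term := hasSum_single
    (f := fun j => ((p j : ℂ) * ⟪ψ j, ψ k⟫_ℂ) • ψ j) k fun j hj => by
      simp [h.orthonormal.2 hj]
  rw [(h.hasSum (ψ k)).unique hasSum_single_term]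
  simp [inner_self_eq_norm_sq_to_K, h.orthonormal.1 k]

theorem hasSum_sum_inner {ι : Type*} (s : Finset ι) (u v : ι → H) :
    HasSum (fun k => (p k : ℂ) * ∑ i ∈ s, ⟪u i, ψ k⟫_ℂ * ⟪ψ k, v i⟫_ℂ)
      (∑ i ∈ s, ⟪u i, γ (v i)⟫_ℂ) := by
  simp_rw [Finset.mul_sum]
  refine hasSum_sum fun i _ => ((h.hasSum (v i)).mapL (innerSL ℂ (u i))).congr_fun fun k => ?_
  rw [innerSL_apply_apply, inner_smul_right]
  ring

theorem traceNorm_le : traceNorm γ ≤ ∑' k, ENNReal.ofReal (p k) := by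
  simp only [traceNorm, iSup_le_iff]
  intro n u v hu hv
  rw [← (h.hasSum_sum_inner Finset.univ u v).tsum_eq]
  refine enorm_tsum_le_tsum_enorm.trans (ENNReal.tsum_le_tsum fun k => ?_)
  rw [← ofReal_norm, norm_mul, Complex.norm_real, Real.norm_of_nonneg (h.nonneg k)]
  refine ENNReal.ofReal_le_ofReal (mul_le_of_le_one_right (h.nonneg k) ?_)
  simpa [h.orthonormal.1 k] using norm_sum_inner_mul_inner_le hu hv Finset.univ (ψ k) (ψ k)

theorem sum_inner_apply_self (n : ℕ) :
    ∑ i : Fin n, ⟪ψ i, γ (ψ i)⟫_ℂ = ((∑ i : Fin n, p i : ℝ) : ℂ) := by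
  rw [Complex.ofReal_sum]
  refine Finset.sum_congr rfl fun i _ => ?_
  rw [h.apply_eq, inner_smul_right, inner_self_eq_norm_sq_to_K, h.orthonormal.1]
  simp

theorem le_traceNorm : ∑' k, ENNReal.ofReal (p k) ≤ traceNorm γ := by
  rw [ENNReal.tsum_eq_iSup_nat]
  refine iSup_le fun n => ?_
  have orthonormal_fin : Orthonormal ℂ fun i : Fin n => ψ i :=
    h.orthonormal.comp _ Fin.val_injective
  calc ∑ k ∈ Finset.range n, ENNReal.ofReal (p k)
    _ = ‖∑ i : Fin n, ⟪ψ i, γ (ψ i)⟫_ℂ‖ₑ := by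
        rw [h.sum_inner_apply_self, ← ofReal_norm, Complex.norm_real,
          Real.norm_of_nonneg (Finset.sum_nonneg fun (i : Fin n) _ => h.nonneg i),
          ENNReal.ofReal_sum_of_nonneg fun (i : Fin n) _ => h.nonneg i,
          Finset.sum_range fun k => ENNReal.ofReal (p k)]
    _ ≤ traceNorm γ :=
        le_iSup_of_le n <| le_iSup_of_le (fun i => ψ i) <| le_iSup_of_le (fun i => ψ i) <|
          le_iSup_of_le orthonormal_fin <| le_iSup_of_le orthonormal_fin le_rfl

theorem traceNorm_eq : traceNorm γ = ∑' k, ENNReal.ofReal (p k) :=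
  h.traceNorm_le.antisymm h.le_traceNorm

theorem extIntegral_eq (hγ : traceNorm γ = 1) {Q : H → EReal} {c : EReal}
    (hQ : ∀ k, p k ≠ 0 → Q (ψ k) = c) :
    extIntegral Measure.count (fun k => (p k : EReal) * Q (ψ k)) = c := by
  rw [← extIntegral_count_mul_const h.nonneg (h.traceNorm_eq ▸ hγ) c]
  congr 1
  funext k
  rcases eq_or_ne (p k) 0 with hk | hk
  · simp only [hk, EReal.coe_zero, zero_mul]
  · rw [hQ k hk]

theorem le_extIntegral (hγ : traceNorm γ = 1) {Q : H → EReal} {c : EReal}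
    (hQ : ∀ k, c ≤ Q (ψ k)) :
    c ≤ extIntegral Measure.count (fun k => (p k : EReal) * Q (ψ k)) := by
  rw [← extIntegral_count_mul_const h.nonneg (h.traceNorm_eq ▸ hγ) c]
  exact extIntegral_mono <| ae_of_all _ fun k =>
    mul_le_mul_of_nonneg_left (hQ k) (EReal.coe_nonneg.2 (h.nonneg k))

end IsSpectralDecomposition

theorem le_traceForm {γ : H →L[ℂ] H} (hγ : traceNorm γ = 1) {Q : H → EReal} {c : EReal}
    (hQ : ∀ φ, ‖φ‖ = 1 → c ≤ Q φ) : c ≤ traceForm Q γ :=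
  le_iInf fun _ => le_iInf fun _ => le_iInf fun h =>
    h.le_extIntegral hγ fun k => hQ _ (h.orthonormal.1 k)

end SpectralDecomposition

section PureState

variable {H : Type*} [NormedAddCommGroup H] [InnerProductSpace ℂ H]

/-- The pure state `|ψ⟩⟨ψ|`. -/
def pureState (ψ : H) : H →L[ℂ] H := InnerProductSpace.rankOne ℂ ψ ψ

theorem pureState_apply (ψ φ : H) : pureState ψ φ = ⟪ψ, φ⟫_ℂ • ψ := rfl

theorem IsSpectralDecomposition.exists_eq_smul_of_pureState {ψ : H} (hψ : ‖ψ‖ = 1) {p : ℕ → ℝ}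
    {e : ℕ → H} (h : IsSpectralDecomposition (pureState ψ) p e) {k : ℕ} (hk : p k ≠ 0) :
    ∃ c : ℂ, ‖c‖ = 1 ∧ e k = c • ψ := by
  have e_eq : e k = ((p k : ℂ)⁻¹ * ⟪ψ, e k⟫_ℂ) • ψ := by
    rw [mul_smul, ← pureState_apply, h.apply_eq, inv_smul_smul₀ (Complex.ofReal_ne_zero.2 hk)]
  refine ⟨_, ?_, e_eq⟩
  rw [← h.orthonormal.1 k, e_eq, norm_smul, hψ, mul_one, ← e_eq]

variable [CompleteSpace H]

theorem exists_isSpectralDecomposition_pureState (hH : ¬ FiniteDimensional ℂ H) {ψ : H}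
    (hψ : ‖ψ‖ = 1) : ∃ e : ℕ → H, IsSpectralDecomposition (pureState ψ) (Pi.single 0 1) e := by
  obtain ⟨e, he, rfl⟩ := exists_orthonormal_seq hH hψ
  refine ⟨e, (Pi.single_nonneg (α := fun _ : ℕ => ℝ)).2 zero_le_one, he, fun φ => ?_⟩
  convert hasSum_single (f := fun k => (((Pi.single 0 1 : ℕ → ℝ) k : ℂ) * ⟪e k, φ⟫_ℂ) • e k) 0
    (fun k hk => by simp [hk]) using 1
  simp [pureState_apply]

theorem traceNorm_pureState (hH : ¬ FiniteDimensional ℂ H) {ψ : H} (hψ : ‖ψ‖ = 1) :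
    traceNorm (pureState ψ) = 1 := by
  obtain ⟨e, he⟩ := exists_isSpectralDecomposition_pureState hH hψ
  rw [he.traceNorm_eq, tsum_eq_single 0 fun k hk => by simp [hk]]
  simp

theorem isDensityMatrix_pureState (hH : ¬ FiniteDimensional ℂ H) {ψ : H} (hψ : ‖ψ‖ = 1) :
    IsDensityMatrix (pureState ψ) :=
  ⟨InnerProductSpace.isPositive_rankOne_self ψ, traceNorm_pureState hH hψ⟩

theorem traceForm_pureState (hH : ¬ FiniteDimensional ℂ H) {Q : H → EReal}
    (hQ : ∀ (c : ℂ) (φ : H), ‖c‖ = 1 → Q (c • φ) = Q φ) {ψ : H} (hψ : ‖ψ‖ = 1) :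
    traceForm Q (pureState ψ) = Q ψ := by
  have extIntegral_eq {p : ℕ → ℝ} {e : ℕ → H} (h : IsSpectralDecomposition (pureState ψ) p e) :
      extIntegral Measure.count (fun k => (p k : EReal) * Q (e k)) = Q ψ :=
    h.extIntegral_eq (traceNorm_pureState hH hψ) fun k hk => by
      obtain ⟨c, hc, he⟩ := h.exists_eq_smul_of_pureState hψ hk
      rw [he, hQ c ψ hc]
  obtain ⟨e, he⟩ := exists_isSpectralDecomposition_pureState hH hψ
  refine le_antisymm ?_ ?_
  · exact iInf_le_of_le _ <| iInf_le_of_le e <| iInf_le_of_le he (extIntegral_eq he).le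
  · exact le_iInf fun p => le_iInf fun e => le_iInf fun h => (extIntegral_eq h).ge

end PureState

section DiracStateValuedMeasure

variable {Z : Type*} [MeasurableSpace Z]
variable {H : Type*} [NormedAddCommGroup H] [InnerProductSpace ℂ H] [CompleteSpace H]

namespace StateValuedMeasure

/-- The state-valued measure `γ δ_z`, where `γ` is a density matrix. -/
def dirac (γ : H →L[ℂ] H) (hγ : IsDensityMatrix γ) (z : Z) : StateValuedMeasure Z H where
  toFun S := S.indicator (fun _ => γ) z
  isPositive S _ := by
    by_cases h : z ∈ S <;> simp [h, hγ.1]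
  traceClass S _ := by
    by_cases h : z ∈ S <;> simp [h, traceNorm_zero, hγ.2]
  empty := by simp
  iUnion _ _ hS := tendsto_traceNorm_indicator_iUnion γ z hS
  norm_univ := by simpa using hγ.2

variable {γ : H →L[ℂ] H} {hγ : IsDensityMatrix γ} {z : Z}

theorem traceNorm_dirac {S : Set Z} (hS : MeasurableSet S) :
    traceNorm ((dirac γ hγ z).toFun S) = Measure.dirac z S := by
  rw [Measure.dirac_apply' _ hS]
  by_cases h : z ∈ S <;> simp [dirac, h, traceNorm_zero, hγ.2]

theorem isAtomic_dirac : (dirac γ hγ z).IsAtomic := ⟨{z}, by simp [dirac]⟩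

variable [MeasurableSingletonClass Z]

theorem isRadonNikodym_dirac : IsRadonNikodym (dirac γ hγ z) (Measure.dirac z) fun _ => γ where
  norm_measure S hS := (traceNorm_dirac hS).symm
  measurable _ _ := measurable_const
  density := ae_of_all _ fun _ => hγ
  integral_eq S _ φ χ := by
    classical
    rw [setIntegral_dirac]
    by_cases h : z ∈ S <;> simp [dirac, h]

theorem eq_dirac_of_isRadonNikodym {μ : Measure Z} {γ' : Z → (H →L[ℂ] H)}
    (h : IsRadonNikodym (dirac γ hγ z) μ γ') : μ = Measure.dirac z ∧ γ' z = γ := by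
  obtain rfl : μ = Measure.dirac z :=
    Measure.ext fun S hS => (h.norm_measure S hS).trans (traceNorm_dirac hS)
  refine ⟨rfl, ContinuousLinearMap.ext fun χ => ext_inner_left ℂ fun φ => ?_⟩
  simpa [dirac] using (h.integral_eq Set.univ MeasurableSet.univ φ χ).symm

theorem svmFunctional_dirac (𝓔 : H → Z → EReal) :
    svmFunctional 𝓔 (dirac γ hγ z) = traceForm (fun ψ => 𝓔 ψ z) γ := by
  refine le_antisymm ?_ ?_
  · refine iInf_le_of_le _ <| iInf_le_of_le _ <| iInf_le_of_le isRadonNikodym_dirac ?_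
    rw [extIntegral_dirac]
  · refine le_iInf fun μ => le_iInf fun γ' => le_iInf fun h => ?_
    obtain ⟨rfl, hγ'⟩ := eq_dirac_of_isRadonNikodym h
    rw [extIntegral_dirac, hγ']

end StateValuedMeasure

end DiracStateValuedMeasure

section QuadraticPolynomial

theorem exists_forall_apply_eq_of_isCoercive {V : Type*} [NormedAddCommGroup V]
    [InnerProductSpace ℝ V] [CompleteSpace V] {B : V →L[ℝ] V →L[ℝ] ℝ} (hB : IsCoercive B)
    (L : V →L[ℝ] ℝ) : ∃ v, ∀ w, B v w = L w := by
  refine ⟨hB.continuousLinearEquivOfBilin.symm ((InnerProductSpace.toDual ℝ V).symm L),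
    fun w => ?_⟩
  rw [← hB.continuousLinearEquivOfBilin_apply, ContinuousLinearEquiv.apply_symm_apply,
    InnerProductSpace.toDual_symm_apply]

variable {Z : Type*} [NormedAddCommGroup Z] [NormedSpace ℂ Z]

/-- `F z = A + L z + B z z`, a real quadratic polynomial on a complex normed space. Functionals of
the field are real-linear only, whence the real scalars. -/
structure IsQuadraticPolynomial (F : Z → ℝ) (A : ℝ) (L : Z →L[ℝ] ℝ) (B : Z →L[ℝ] Z →L[ℝ] ℝ) :
    Prop where
  symm : ∀ z w, B z w = B w z
  eq : ∀ z, F z = A + L z + B z z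

/-- Quadratic polynomials whose leading part is nonnegative. -/
def IsConvexQuadratic (F : Z → ℝ) : Prop :=
  ∃ A L B, IsQuadraticPolynomial F A L B ∧ ∀ z, 0 ≤ B z z

/-- Quadratic polynomials whose leading part is coercive. -/
def IsCoerciveQuadratic (F : Z → ℝ) : Prop :=
  ∃ A L B, IsQuadraticPolynomial F A L B ∧ IsCoercive B

namespace IsQuadraticPolynomial

variable {F : Z → ℝ} {A : ℝ} {L : Z →L[ℝ] ℝ} {B : Z →L[ℝ] Z →L[ℝ] ℝ}
  (hF : IsQuadraticPolynomial F A L B)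
include hF

theorem apply_add_smul (z ζ : Z) (t : ℝ) :
    F (z + (t : ℂ) • ζ) = F z + t * (L ζ + 2 * B z ζ) + t ^ 2 * B ζ ζ := by
  simp only [hF.eq, Complex.coe_smul, map_add, map_smul, add_apply,
    smul_apply, smul_eq_mul, hF.symm ζ z]
  ring

theorem hasDerivAt_line (z ζ : Z) :
    HasDerivAt (fun t : ℝ => F (z + (t : ℂ) • ζ)) (L ζ + 2 * B z ζ) 0 := by
  simp only [hF.apply_add_smul]
  have linear := (hasDerivAt_id (0 : ℝ)).mul_const (L ζ + 2 * B z ζ)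
  have quadratic := (hasDerivAt_pow 2 (0 : ℝ)).mul_const (B ζ ζ)
  exact ((linear.const_add (F z)).fun_add quadratic).congr_deriv (by simp)

end IsQuadraticPolynomial

namespace IsConvexQuadratic

theorem const (c : ℝ) : IsConvexQuadratic fun _ : Z => c :=
  ⟨c, 0, 0, ⟨by simp, by simp⟩, by simp⟩

theorem linear (L : Z →L[ℝ] ℝ) : IsConvexQuadratic fun z => L z :=
  ⟨0, L, 0, ⟨by simp, by simp⟩, by simp⟩

theorem norm_add_sq {K : Type*} [NormedAddCommGroup K] [InnerProductSpace ℝ K] (u : K)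
    (T : Z →L[ℝ] K) : IsConvexQuadratic fun z => ‖u + T z‖ ^ 2 := by
  let I : K →L[ℝ] K →L[ℝ] ℝ := (isBoundedBilinearMap_inner (𝕜 := ℝ)).toContinuousLinearMap
  have I_apply (v w : K) : I v w = ⟪v, w⟫_ℝ := rfl
  refine ⟨‖u‖ ^ 2, 2 • (I u).comp T, I.bilinearComp T T, ⟨fun z w => ?_, fun z => ?_⟩,
    fun z => ?_⟩
  · exact real_inner_comm _ _
  · simp [I_apply, norm_add_sq_real]
  · exact real_inner_self_nonneg

variable {F G : Z → ℝ}

theorem add (hF : IsConvexQuadratic F) (hG : IsConvexQuadratic G) :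
    IsConvexQuadratic fun z => F z + G z := by
  obtain ⟨A, L, B, hF, hB⟩ := hF
  obtain ⟨A', L', B', hG, hB'⟩ := hG
  refine ⟨A + A', L + L', B + B', ⟨fun z w => ?_, fun z => ?_⟩, fun z => add_nonneg (hB z) (hB' z)⟩
  · simp [hF.symm z w, hG.symm z w]
  · simp only [hF.eq, hG.eq, add_apply]
    ring

theorem const_mul (hF : IsConvexQuadratic F) {c : ℝ} (hc : 0 ≤ c) :
    IsConvexQuadratic fun z => c * F z := by
  obtain ⟨A, L, B, hF, hB⟩ := hF
  refine ⟨c * A, c • L, c • B, ⟨fun z w => ?_, fun z => ?_⟩, fun z => mul_nonneg hc (hB z)⟩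
  · simp [hF.symm z w]
  · simp only [hF.eq, smul_apply, smul_eq_mul]
    ring

theorem sum {ι : Type*} (s : Finset ι) {F : ι → Z → ℝ} (hF : ∀ i, IsConvexQuadratic (F i)) :
    IsConvexQuadratic fun z => ∑ i ∈ s, F i z := by
  classical
  induction s using Finset.induction_on with
  | empty => simpa only [Finset.sum_empty] using const 0
  | insert i s hi ih => simpa only [Finset.sum_insert hi] using (hF i).add ih

theorem le_of_hasDerivAt_line_zero {F : Z → ℝ} (hF : IsConvexQuadratic F) {z : Z}
    (hz : ∀ ζ : Z, HasDerivAt (fun t : ℝ => F (z + (t : ℂ) • ζ)) 0 0) (w : Z) : F z ≤ F w := by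
  obtain ⟨A, L, B, hF, hB⟩ := hF
  have expansion := hF.apply_add_smul z (w - z) 1
  rw [← (hz (w - z)).unique (hF.hasDerivAt_line z (w - z)), Complex.ofReal_one, one_smul,
    add_sub_cancel] at expansion
  linarith [hB (w - z)]

end IsConvexQuadratic

theorem IsConvexQuadratic.add_norm_sq {Z : Type*} [NormedAddCommGroup Z] [InnerProductSpace ℂ Z]
    {F : Z → ℝ} (hF : IsConvexQuadratic F) : IsCoerciveQuadratic fun z => F z + ‖z‖ ^ 2 := by
  obtain ⟨A, L, B, hF, hB⟩ := hF
  let _ : InnerProductSpace ℝ Z := InnerProductSpace.complexToReal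
  let I : Z →L[ℝ] Z →L[ℝ] ℝ := (isBoundedBilinearMap_inner (𝕜 := ℝ)).toContinuousLinearMap
  have I_symm (z w : Z) : I z w = I w z := real_inner_comm w z
  have I_self (z : Z) : I z z = ‖z‖ ^ 2 := real_inner_self_eq_norm_sq z
  refine ⟨A, L, B + I, ⟨fun z w => ?_, fun z => ?_⟩, 1, one_pos, fun z => ?_⟩
  · simp [hF.symm z w, I_symm z w]
  · simp only [hF.eq, add_apply, I_self, add_assoc]
  · simpa [I_self, ← sq] using hB z

namespace IsCoerciveQuadratic

theorem isConvexQuadratic {F : Z → ℝ} (hF : IsCoerciveQuadratic F) : IsConvexQuadratic F := by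
  obtain ⟨A, L, B, hF, C, hC, hB⟩ := hF
  exact ⟨A, L, B, hF, fun z => le_trans (by positivity) (hB z)⟩

theorem exists_hasDerivAt_line_zero {Z : Type*} [NormedAddCommGroup Z] [InnerProductSpace ℂ Z]
    [CompleteSpace Z] {F : Z → ℝ} (hF : IsCoerciveQuadratic F) :
    ∃ z, ∀ ζ : Z, HasDerivAt (fun t : ℝ => F (z + (t : ℂ) • ζ)) 0 0 := by
  obtain ⟨A, L, B, hF, hB⟩ := hF
  let _ : InnerProductSpace ℝ Z := InnerProductSpace.complexToReal
  obtain ⟨z, hz⟩ := exists_forall_apply_eq_of_isCoercive hB ((-(1 / 2) : ℝ) • L)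
  refine ⟨z, fun ζ => (hF.hasDerivAt_line z ζ).congr_deriv ?_⟩
  rw [hz, smul_apply, smul_eq_mul]
  ring

end IsCoerciveQuadratic

end QuadraticPolynomial

section QuasiClassicalEnergies

variable {Z H : Type*} [NormedAddCommGroup H] {𝓔 : H → Z → EReal}

theorem qcEnergy_le {ψ : H} (hψ : ‖ψ‖ = 1) {z : Z} (h : 𝓔 ψ z ≠ ⊥) : qcEnergy 𝓔 ≤ 𝓔 ψ z := by
  by_cases htop : 𝓔 ψ z = ⊤
  · exact htop ▸ le_top
  · exact iInf_le_of_le ψ <| iInf_le_of_le z <| iInf_le_of_le hψ <| iInf_le _ ⟨htop, h⟩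

theorem iInf_fieldFunctional_le_qcEnergy : ⨅ z, fieldFunctional 𝓔 z ≤ qcEnergy 𝓔 :=
  le_iInf fun ψ => le_iInf fun z => le_iInf fun hψ => le_iInf fun _ =>
    iInf_le_of_le z <| iInf_le_of_le ψ <| iInf_le _ hψ

section LowerBounds

variable {c : EReal} (hc : ∀ ψ z, ‖ψ‖ = 1 → c ≤ 𝓔 ψ z)
include hc

theorem le_svmFunctional [MeasurableSpace Z] [InnerProductSpace ℂ H] [CompleteSpace H]
    (𝔪 : StateValuedMeasure Z H) : c ≤ svmFunctional 𝓔 𝔪 := by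
  refine le_iInf fun μ => le_iInf fun γ => le_iInf fun h => ?_
  have : IsProbabilityMeasure μ := ⟨(h.norm_measure _ .univ).trans 𝔪.norm_univ⟩
  rw [← extIntegral_const μ c]
  exact extIntegral_mono <| h.density.mono fun z hz => le_traceForm hz.2 fun ψ hψ => hc ψ z hψ

theorem le_svmEnergy [MeasurableSpace Z] [InnerProductSpace ℂ H] [CompleteSpace H] :
    c ≤ svmEnergy 𝓔 :=
  le_iInf fun 𝔪 => le_iInf fun _ => le_svmFunctional hc 𝔪

theorem le_pmEnergy [MeasurableSpace Z] : c ≤ pmEnergy 𝓔 := by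
  refine le_iInf fun ψ => le_iInf fun μ => le_iInf fun hψ => le_iInf fun _ => le_iInf fun _ => ?_
  rw [← extIntegral_const μ c]
  exact extIntegral_mono <| ae_of_all _ fun z => hc ψ z hψ

theorem le_waveEnergy_pekarFunctional : c ≤ waveEnergy (pekarFunctional 𝓔) :=
  le_iInf fun ψ => le_iInf fun hψ => le_iInf fun _ => le_iInf fun z => hc ψ z hψ

theorem le_iInf_fieldFunctional : c ≤ ⨅ z, fieldFunctional 𝓔 z :=
  le_iInf fun z => le_iInf fun ψ => le_iInf fun hψ => hc ψ z hψ

end LowerBounds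

section UpperBounds

variable [MeasurableSpace Z]

theorem svmEnergy_le_svmAtomicEnergy [InnerProductSpace ℂ H] [CompleteSpace H] :
    svmEnergy 𝓔 ≤ svmAtomicEnergy 𝓔 :=
  le_iInf fun 𝔪 => le_iInf fun _ => le_iInf fun h => iInf_le_of_le 𝔪 <| iInf_le _ h

theorem pmEnergy_le_pmAtomicEnergy : pmEnergy 𝓔 ≤ pmAtomicEnergy 𝓔 :=
  le_iInf fun ψ => le_iInf fun μ => le_iInf fun hψ => le_iInf fun hμ => le_iInf fun _ =>
    le_iInf fun h => iInf_le_of_le ψ <| iInf_le_of_le μ <| iInf_le_of_le hψ <|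
      iInf_le_of_le hμ <| iInf_le _ h

variable [MeasurableSingletonClass Z]

theorem svmAtomicEnergy_le_qcEnergy [InnerProductSpace ℂ H] [CompleteSpace H]
    (hH : ¬ FiniteDimensional ℂ H)
    (hphase : ∀ (c : ℂ) (ψ : H) (z : Z), ‖c‖ = 1 → 𝓔 (c • ψ) z = 𝓔 ψ z) :
    svmAtomicEnergy 𝓔 ≤ qcEnergy 𝓔 := by
  refine le_iInf fun ψ => le_iInf fun z => le_iInf fun hψ => le_iInf fun hfin => ?_
  let 𝔪 := StateValuedMeasure.dirac (pureState ψ) (isDensityMatrix_pureState hH hψ) z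
  have svmFunctional_eq : svmFunctional 𝓔 𝔪 = 𝓔 ψ z := by
    rw [StateValuedMeasure.svmFunctional_dirac,
      traceForm_pureState hH (fun c φ => hphase c φ z) hψ]
  exact iInf_le_of_le 𝔪 <| iInf_le_of_le StateValuedMeasure.isAtomic_dirac <|
    iInf_le_of_le (svmFunctional_eq ▸ hfin) svmFunctional_eq.le

theorem pmAtomicEnergy_le_qcEnergy : pmAtomicEnergy 𝓔 ≤ qcEnergy 𝓔 := by
  refine le_iInf fun ψ => le_iInf fun z => le_iInf fun hψ => le_iInf fun hfin => ?_
  have pmFunctional_eq : pmFunctional 𝓔 ψ (Measure.dirac z) = 𝓔 ψ z := extIntegral_dirac z _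
  exact iInf_le_of_le ψ <| iInf_le_of_le (Measure.dirac z) <| iInf_le_of_le hψ <|
    iInf_le_of_le inferInstance <| iInf_le_of_le ⟨{z}, by simp⟩ <|
      iInf_le_of_le (pmFunctional_eq ▸ hfin) pmFunctional_eq.le

end UpperBounds

end QuasiClassicalEnergies

section QuadraticInField

variable {Z : Type*} [NormedAddCommGroup Z] [NormedSpace ℂ Z]
variable {H : Type*} [NormedAddCommGroup H] [InnerProductSpace ℂ H]

/-- A functional of a wave function and a field which is invariant under a change of phase of the
wave function and which, at every normalized wave function, is either identically `⊤` or a coercive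
quadratic polynomial of the field. -/
structure IsQuadraticInField (𝓔 : H → Z → EReal) : Prop where
  phase : ∀ (c : ℂ) (ψ : H) (z : Z), ‖c‖ = 1 → 𝓔 (c • ψ) z = 𝓔 ψ z
  quadratic : ∀ ψ, ‖ψ‖ = 1 → (∀ z, 𝓔 ψ z = ⊤) ∨
    ∃ F : Z → ℝ, IsCoerciveQuadratic F ∧ ∀ z, 𝓔 ψ z = F z

namespace IsQuadraticInField

variable {𝓔 : H → Z → EReal} {ψ : H}

theorem ne_bot (h𝓔 : IsQuadraticInField 𝓔) (hψ : ‖ψ‖ = 1) (z : Z) : 𝓔 ψ z ≠ ⊥ := by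
  obtain htop | ⟨F, -, hF⟩ := h𝓔.quadratic ψ hψ
  · simp [htop]
  · simp [hF]

theorem le_of_isCriticalField (h𝓔 : IsQuadraticInField 𝓔) (hψ : ‖ψ‖ = 1) {z : Z}
    (hz : IsCriticalField 𝓔 ψ z) (w : Z) : 𝓔 ψ z ≤ 𝓔 ψ w := by
  obtain htop | ⟨F, hquad, hF⟩ := h𝓔.quadratic ψ hψ
  · simp [htop]
  · rw [hF, hF, EReal.coe_le_coe_iff]
    refine hquad.isConvexQuadratic.le_of_hasDerivAt_line_zero (fun ζ => ?_) w
    simpa only [hF, EReal.toReal_coe] using hz ζ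

end IsQuadraticInField

end QuadraticInField

theorem isQuadraticInField_ite {Z : Type*} [NormedAddCommGroup Z] [InnerProductSpace ℂ Z]
    {H : Type*} [NormedAddCommGroup H] [InnerProductSpace ℂ H] {D : H → Prop} [DecidablePred D]
    {F : H → Z → ℝ} (domain : ∀ (c : ℂ) ψ, c ≠ 0 → (D (c • ψ) ↔ D ψ))
    (smul : ∀ (c : ℂ) ψ z, D ψ → F (c • ψ) z = ‖c‖ ^ 2 * F ψ z)
    (convex : ∀ ψ, D ψ → IsConvexQuadratic (F ψ)) :
    IsQuadraticInField fun ψ z => if D ψ then ((F ψ z + ‖z‖ ^ 2 * ‖ψ‖ ^ 2 : ℝ) : EReal) else ⊤ where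
  phase c ψ z hc := by
    have c_ne_zero : c ≠ 0 := by rintro rfl; simp at hc
    refine if_ctx_congr (domain c ψ c_ne_zero) (fun hψ => ?_) fun _ => rfl
    rw [smul c ψ z hψ, norm_smul, hc, one_pow, one_mul, one_mul]
  quadratic ψ hψ := by
    by_cases h : D ψ
    · exact Or.inr ⟨_, (convex ψ h).add_norm_sq, fun z => by simp [h, hψ]⟩
    · exact Or.inl fun z => if_neg h

namespace IsQuadraticInField

variable {Z : Type*} [NormedAddCommGroup Z] [InnerProductSpace ℂ Z] [CompleteSpace Z]
variable {H : Type*} [NormedAddCommGroup H] [InnerProductSpace ℂ H]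
variable {𝓔 : H → Z → EReal} (h𝓔 : IsQuadraticInField 𝓔)
include h𝓔

theorem exists_isCriticalField {ψ : H} (hψ : ‖ψ‖ = 1) : ∃ z, IsCriticalField 𝓔 ψ z := by
  obtain htop | ⟨F, hquad, hF⟩ := h𝓔.quadratic ψ hψ
  · exact ⟨0, fun ζ => by simpa only [htop, EReal.toReal_top] using hasDerivAt_const _ _⟩
  · obtain ⟨z, hz⟩ := hquad.exists_hasDerivAt_line_zero
    exact ⟨z, fun ζ => by simpa only [hF, EReal.toReal_coe] using hz ζ⟩

theorem exists_pekarFunctional_eq {ψ : H} (hψ : ‖ψ‖ = 1) :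
    ∃ z, IsCriticalField 𝓔 ψ z ∧ pekarFunctional 𝓔 ψ = 𝓔 ψ z := by
  obtain ⟨z, hz⟩ := h𝓔.exists_isCriticalField hψ
  exact ⟨z, hz, (iInf_le _ z).antisymm (le_iInf (h𝓔.le_of_isCriticalField hψ hz))⟩

theorem pekarImplicitFunctional_eq {ψ : H} (hψ : ‖ψ‖ = 1) :
    pekarImplicitFunctional 𝓔 ψ = pekarFunctional 𝓔 ψ := by
  obtain ⟨z, hz, pekar_eq⟩ := h𝓔.exists_pekarFunctional_eq hψ
  refine le_antisymm ?_ (le_iInf fun w => le_iInf fun _ => iInf_le _ w)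
  exact iInf_le_of_le z <| iInf_le_of_le hz pekar_eq.ge

theorem waveEnergy_pekarImplicitFunctional_eq :
    waveEnergy (pekarImplicitFunctional 𝓔) = waveEnergy (pekarFunctional 𝓔) :=
  iInf_congr fun ψ => iInf_congr fun hψ => by rw [h𝓔.pekarImplicitFunctional_eq hψ]

theorem waveEnergy_pekarFunctional_le : waveEnergy (pekarFunctional 𝓔) ≤ qcEnergy 𝓔 := by
  refine le_iInf fun ψ => le_iInf fun z => le_iInf fun hψ => le_iInf fun hfin => ?_
  obtain ⟨z₀, -, pekar_eq⟩ := h𝓔.exists_pekarFunctional_eq hψ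
  have pekar_le : pekarFunctional 𝓔 ψ ≤ 𝓔 ψ z := iInf_le _ z
  refine iInf_le_of_le ψ <| iInf_le_of_le hψ <| iInf_le_of_le ⟨?_, ?_⟩ pekar_le
  · exact ne_top_of_le_ne_top hfin.1 pekar_le
  · exact pekar_eq ▸ h𝓔.ne_bot hψ z₀

theorem energiesCoincide [MeasurableSpace Z] [BorelSpace Z] [CompleteSpace H]
    (hH : ¬ FiniteDimensional ℂ H) : EnergiesCoincide 𝓔 := by
  have hqc (ψ : H) (z : Z) (hψ : ‖ψ‖ = 1) : qcEnergy 𝓔 ≤ 𝓔 ψ z := qcEnergy_le hψ (h𝓔.ne_bot hψ z)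
  have hatom : svmAtomicEnergy 𝓔 ≤ qcEnergy 𝓔 := svmAtomicEnergy_le_qcEnergy hH h𝓔.phase
  have hsvm : svmEnergy 𝓔 = qcEnergy 𝓔 :=
    (svmEnergy_le_svmAtomicEnergy.trans hatom).antisymm (le_svmEnergy hqc)
  have hsvmAtomic : svmAtomicEnergy 𝓔 = qcEnergy 𝓔 :=
    hatom.antisymm (hsvm.ge.trans svmEnergy_le_svmAtomicEnergy)
  have hpm : pmEnergy 𝓔 = qcEnergy 𝓔 :=
    (pmEnergy_le_pmAtomicEnergy.trans pmAtomicEnergy_le_qcEnergy).antisymm (le_pmEnergy hqc)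
  have hpmAtomic : pmAtomicEnergy 𝓔 = qcEnergy 𝓔 :=
    pmAtomicEnergy_le_qcEnergy.antisymm (hpm.ge.trans pmEnergy_le_pmAtomicEnergy)
  have hpekar : waveEnergy (pekarFunctional 𝓔) = qcEnergy 𝓔 :=
    h𝓔.waveEnergy_pekarFunctional_le.antisymm (le_waveEnergy_pekarFunctional hqc)
  have hfield : ⨅ z, fieldFunctional 𝓔 z = qcEnergy 𝓔 :=
    iInf_fieldFunctional_le_qcEnergy.antisymm (le_iInf_fieldFunctional hqc)
  simp only [EnergiesCoincide, h𝓔.waveEnergy_pekarImplicitFunctional_eq, hsvm, hsvmAtomic, hpm,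
    hpmAtomic, hpekar, hfield, and_self]

end IsQuadraticInField

section FormFactor

variable {Z : Type*} [NormedAddCommGroup Z] [InnerProductSpace ℂ Z]
variable {X Y : Type*} [MeasurableSpace X] [MeasurableSpace Y] {μ : Measure X} {ν : Measure Y}

/-- `a z x = Re ⟨z, η x⟩` for an essentially bounded form factor `η`, so that `z ↦ a z` is a bounded
real-linear map into `L^∞`. No measurability of `η` itself is required. -/
structure IsFormFactorPotential (μ : Measure X) (a : Z → X → ℝ) : Prop where
  aestronglyMeasurable : ∀ z, AEStronglyMeasurable (a z) μ
  exists_formFactor : ∃ C : ℝ, ∀ᵐ x ∂μ, ∃ η : Z, ‖η‖ ≤ C ∧ ∀ z, a z x = (⟪z, η⟫_ℂ).re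

namespace IsFormFactorPotential

variable {a : Z → X → ℝ}

theorem comp (ha : IsFormFactorPotential μ a) {f : Y → X}
    (hf : Measure.QuasiMeasurePreserving f ν μ) : IsFormFactorPotential ν fun z y => a z (f y) where
  aestronglyMeasurable z := (ha.aestronglyMeasurable z).comp_quasiMeasurePreserving hf
  exists_formFactor := by
    obtain ⟨C, hC⟩ := ha.exists_formFactor
    exact ⟨C, hf.ae hC⟩

theorem const_mul (ha : IsFormFactorPotential μ a) (c : ℝ) :
    IsFormFactorPotential μ fun z x => c * a z x where
  aestronglyMeasurable z := (ha.aestronglyMeasurable z).const_mul c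
  exists_formFactor := by
    obtain ⟨C, hC⟩ := ha.exists_formFactor
    refine ⟨|c| * C, hC.mono fun x ⟨η, hη, h⟩ => ⟨(c : ℂ) • η, ?_, fun z => ?_⟩⟩
    · rw [norm_smul, Complex.norm_real, Real.norm_eq_abs]
      gcongr
    · rw [h, inner_smul_right, Complex.re_ofReal_mul]

theorem map_add (ha : IsFormFactorPotential μ a) (z w : Z) :
    a (z + w) =ᵐ[μ] fun x => a z x + a w x := by
  obtain ⟨C, hC⟩ := ha.exists_formFactor
  filter_upwards [hC] with x ⟨η, _, h⟩
  simp only [h, inner_add_left, Complex.add_re]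

theorem map_smul (ha : IsFormFactorPotential μ a) (t : ℝ) (z : Z) :
    a (t • z) =ᵐ[μ] fun x => t * a z x := by
  obtain ⟨C, hC⟩ := ha.exists_formFactor
  filter_upwards [hC] with x ⟨η, _, h⟩
  rw [h, h, ← Complex.coe_smul, inner_smul_left, Complex.conj_ofReal, Complex.re_ofReal_mul]

theorem exists_norm_le (ha : IsFormFactorPotential μ a) :
    ∃ C : ℝ, ∀ z, ∀ᵐ x ∂μ, ‖a z x‖ ≤ C * ‖z‖ := by
  obtain ⟨C, hC⟩ := ha.exists_formFactor
  refine ⟨C, fun z => hC.mono fun x ⟨η, hη, h⟩ => ?_⟩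
  calc ‖a z x‖ = ‖(⟪z, η⟫_ℂ).re‖ := by rw [h]
    _ ≤ ‖z‖ * ‖η‖ := (Complex.abs_re_le_norm _).trans (norm_inner_le_norm z η)
    _ ≤ C * ‖z‖ := by rw [mul_comm]; gcongr

variable {E : Type*} [NormedAddCommGroup E] [NormedSpace ℝ E]

theorem exists_smulOperator (ha : IsFormFactorPotential μ a) {p : ℝ≥0∞} [Fact (1 ≤ p)] {ψ : X → E}
    (hψ : MemLp ψ p μ) :
    ∃ T : Z →L[ℝ] Lp E p μ, ∀ z, ∀ᵐ x ∂μ, T z x = a z x • ψ x := by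
  obtain ⟨C, hC⟩ := ha.exists_norm_le
  have norm_le (z : Z) : ∀ᵐ x ∂μ, ‖a z x • ψ x‖ ≤ C * ‖z‖ * ‖ψ x‖ := by
    filter_upwards [hC z] with x hx
    rw [norm_smul]
    gcongr
  have memLp (z : Z) : MemLp (fun x => a z x • ψ x) p μ :=
    hψ.of_le_mul ((ha.aestronglyMeasurable z).smul hψ.1) (norm_le z)
  have coeFn_toLp (z : Z) : (memLp z).toLp =ᵐ[μ] fun x => a z x • ψ x := (memLp z).coeFn_toLp
  have toLp_add (z w : Z) : (memLp (z + w)).toLp = (memLp z).toLp + (memLp w).toLp := by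
    rw [← MemLp.toLp_add, MemLp.toLp_eq_toLp_iff]
    filter_upwards [ha.map_add z w] with x hx
    rw [hx, add_smul, Pi.add_apply]
  have toLp_smul (t : ℝ) (z : Z) : (memLp (t • z)).toLp = t • (memLp z).toLp := by
    rw [← MemLp.toLp_const_smul, MemLp.toLp_eq_toLp_iff]
    filter_upwards [ha.map_smul t z] with x hx
    rw [hx, Pi.smul_apply, mul_smul]
  let T : Z →ₗ[ℝ] Lp E p μ := ⟨⟨fun z => (memLp z).toLp, toLp_add⟩, toLp_smul⟩
  refine ⟨T.mkContinuous (C * ‖hψ.toLp‖) fun z => ?_, coeFn_toLp⟩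
  calc ‖(memLp z).toLp‖ ≤ C * ‖z‖ * ‖hψ.toLp‖ := by
        refine Lp.norm_le_mul_norm_of_ae_le_mul ?_
        filter_upwards [norm_le z, coeFn_toLp z, hψ.coeFn_toLp] with x hx hTx hψx
        rwa [hTx, hψx]
    _ = C * ‖hψ.toLp‖ * ‖z‖ := by ring

theorem isConvexQuadratic_integral (ha : IsFormFactorPotential μ a) {w : X → ℝ}
    (hw : Integrable w μ) : IsConvexQuadratic fun z => ∫ x, a z x * w x ∂μ := by
  obtain ⟨T, hT⟩ := ha.exists_smulOperator (memLp_one_iff_integrable.2 hw)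
  have integral_eq (z : Z) : ∫ x, a z x * w x ∂μ = (L1.integralCLM' ℝ ∘L T) z := by
    simp only [← smul_eq_mul]
    rw [← integral_congr_ae (hT z), ← L1.integral_eq_integral, L1.integral_eq]
    rfl
  simpa only [integral_eq] using IsConvexQuadratic.linear (L1.integralCLM' ℝ ∘L T)

theorem isConvexQuadratic_integral_norm_add_sq {E : Type*} [NormedAddCommGroup E]
    [InnerProductSpace ℝ E] (ha : IsFormFactorPotential μ a) {φ ψ : X → E} (hφ : MemLp φ 2 μ)
    (hψ : MemLp ψ 2 μ) : IsConvexQuadratic fun z => ∫ x, ‖φ x + a z x • ψ x‖ ^ 2 ∂μ := by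
  obtain ⟨T, hT⟩ := ha.exists_smulOperator hψ
  have integral_eq (z : Z) : ∫ x, ‖φ x + a z x • ψ x‖ ^ 2 ∂μ = ‖hφ.toLp + T z‖ ^ 2 := by
    rw [← real_inner_self_eq_norm_sq, L2.inner_def]
    refine integral_congr_ae ?_
    filter_upwards [hT z, hφ.coeFn_toLp, Lp.coeFn_add hφ.toLp (T z)] with x hTx hφx hadd
    rw [hadd, Pi.add_apply, hTx, hφx, real_inner_self_eq_norm_sq]
  simpa only [integral_eq] using IsConvexQuadratic.norm_add_sq hφ.toLp T

end IsFormFactorPotential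

end FormFactor

theorem not_finiteDimensional_Lp_two (𝕜 : Type*) [RCLike 𝕜] {X : Type*} [TopologicalSpace X]
    [T2Space X] [Infinite X] [MeasurableSpace X] [OpensMeasurableSpace X] (μ : Measure X)
    [IsLocallyFiniteMeasure μ] [μ.IsOpenPosMeasure] : ¬ FiniteDimensional 𝕜 (Lp 𝕜 2 μ) := by
  intro _
  obtain ⟨U, U_infinite, U_open, U_disjoint⟩ := exists_seq_infinite_isOpen_pairwise_disjoint X
  choose x hx using fun n => (U_infinite n).nonempty
  choose V x_mem V_open V_finite using fun n => Measure.exists_isOpen_measure_lt_top μ (x n)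
  let s (n : ℕ) : Set X := U n ∩ V n
  have s_open (n : ℕ) : IsOpen (s n) := (U_open n).inter (V_open n)
  have s_finite (n : ℕ) : μ (s n) ≠ ⊤ := measure_ne_top_of_subset Set.inter_subset_right
    (V_finite n).ne
  have s_pos (n : ℕ) : μ (s n) ≠ 0 := ((s_open n).measure_pos μ ⟨x n, hx n, x_mem n⟩).ne'
  have s_disjoint {m n : ℕ} (h : m ≠ n) : Disjoint (s m) (s n) :=
    (U_disjoint h).mono Set.inter_subset_left Set.inter_subset_left
  let v (n : ℕ) : Lp 𝕜 2 μ := indicatorConstLp 2 (s_open n).measurableSet (s_finite n) 1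
  have inner_v (m n : ℕ) : ⟪v m, v n⟫_𝕜 = (μ.real (s m ∩ s n) : 𝕜) :=
    L2.inner_indicatorConstLp_one_indicatorConstLp_one _ _ _ _
  have v_ne_zero (n : ℕ) : v n ≠ 0 := by
    rw [← inner_self_ne_zero (𝕜 := 𝕜), inner_v, Set.inter_self]
    exact_mod_cast (ENNReal.toReal_pos (s_pos n) (s_finite n)).ne'
  have v_orthogonal : Pairwise fun m n => ⟪v m, v n⟫_𝕜 = 0 := fun m n h => by
    simp [inner_v, (s_disjoint h).inter_eq]
  have v_independent := linearIndependent_of_ne_zero_of_inner_eq_zero v_ne_zero v_orthogonal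
  exact not_finite_iff_infinite.2 inferInstance v_independent.finite

section Particles

variable {d N : ℕ}

theorem not_finiteDimensional_particleSpace (hd : 1 ≤ d) (hN : 1 ≤ N) :
    ¬ FiniteDimensional ℂ (ParticleSpace d N) := by
  have : Nonempty (Fin N × Fin d) := ⟨⟨⟨0, hN⟩, ⟨0, hd⟩⟩⟩
  have : Infinite (Config d N) := Module.Free.infinite ℝ _
  exact not_finiteDimensional_Lp_two ℂ volume

theorem quasiMeasurePreserving_position (j : Fin N) :
    Measure.QuasiMeasurePreserving (position (d := d) j) volume volume := by
  let P : Config d N →ₗ[ℝ] Space d := ⟨⟨position j, fun _ _ => rfl⟩, fun _ _ => rfl⟩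
  have P_surjective : Function.Surjective P := fun x => ⟨WithLp.toLp 2 fun a => x a.2, rfl⟩
  obtain ⟨c, -, hc⟩ := P.exists_map_addHaar_eq_smul_addHaar volume volume P_surjective
  refine ⟨P.continuous_of_finiteDimensional.measurable, ?_⟩
  change Measure.map P volume ≪ volume
  exact hc ▸ Measure.smul_absolutelyContinuous

theorem IsWeakGradient.unique {ψ : ParticleSpace d N} {G G' : Fin N × Fin d → ParticleSpace d N}
    (hG : IsWeakGradient ψ G) (hG' : IsWeakGradient ψ G') : G = G' := by
  refine funext fun a => Lp.ext ?_
  refine ae_eq_of_integral_contDiff_smul_eq ((Lp.memLp (G a)).locallyIntegrable (by norm_num))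
    ((Lp.memLp (G' a)).locallyIntegrable (by norm_num)) fun φ hφ hφ' => ?_
  simpa [mul_comm] using (hG a φ hφ hφ').symm.trans (hG' a φ hφ hφ')

theorem ae_smul_eq (c : ℂ) (ψ : ParticleSpace d N) : ∀ᵐ X, (c • ψ) X = c * ψ X :=
  Lp.coeFn_smul c ψ

theorem IsWeakGradient.smul {ψ : ParticleSpace d N} {G : Fin N × Fin d → ParticleSpace d N}
    (hG : IsWeakGradient ψ G) (c : ℂ) : IsWeakGradient (c • ψ) (c • G) := by
  intro a φ hφ hφ'
  have integral_smul_mul (φ : Config d N → ℂ) (u : ParticleSpace d N) :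
      ∫ X, (c • u) X * φ X = c * ∫ X, u X * φ X := by
    rw [← integral_const_mul]
    refine integral_congr_ae ?_
    filter_upwards [ae_smul_eq c u] with X hX
    rw [hX, mul_assoc]
  rw [integral_smul_mul (fun X => fderiv ℝ φ X (EuclideanSpace.single a 1)), hG a φ hφ hφ',
    Pi.smul_apply, integral_smul_mul (fun X => φ X), mul_neg]

theorem MemH1.isWeakGradient {ψ : ParticleSpace d N} (h : MemH1 ψ) :
    IsWeakGradient ψ (weakGrad ψ) := by
  rw [weakGrad, dif_pos h]
  exact h.choose_spec

theorem MemH1.smul {ψ : ParticleSpace d N} (h : MemH1 ψ) (c : ℂ) : MemH1 (c • ψ) :=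
  ⟨_, h.isWeakGradient.smul c⟩

theorem MemH1.weakGrad_smul {ψ : ParticleSpace d N} (h : MemH1 ψ) (c : ℂ) :
    weakGrad (c • ψ) = c • weakGrad ψ :=
  (h.smul c).isWeakGradient.unique (h.isWeakGradient.smul c)

theorem MemH1.sum_norm_weakGrad_smul_sq {ψ : ParticleSpace d N} (h : MemH1 ψ) (c : ℂ) :
    ∑ a, ‖weakGrad (c • ψ) a‖ ^ 2 = ‖c‖ ^ 2 * ∑ a, ‖weakGrad ψ a‖ ^ 2 := by
  simp only [h.weakGrad_smul, Pi.smul_apply, norm_smul, mul_pow, Finset.mul_sum]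

theorem ae_mul_norm_smul_sq (f : Config d N → ℝ) (c : ℂ) (ψ : ParticleSpace d N) :
    (fun X => f X * ‖(c • ψ) X‖ ^ 2) =ᵐ[volume] fun X => ‖c‖ ^ 2 * (f X * ‖ψ X‖ ^ 2) := by
  filter_upwards [ae_smul_eq c ψ] with X hX
  rw [hX, norm_mul, mul_pow, mul_left_comm]

theorem integral_mul_norm_smul_sq (f : Config d N → ℝ) (c : ℂ) (ψ : ParticleSpace d N) :
    ∫ X, f X * ‖(c • ψ) X‖ ^ 2 = ‖c‖ ^ 2 * ∫ X, f X * ‖ψ X‖ ^ 2 := by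
  rw [integral_congr_ae (ae_mul_norm_smul_sq f c ψ), integral_const_mul]

theorem Potential.energy_smul (V : Potential d N) (c : ℂ) (ψ : ParticleSpace d N) :
    V.energy (c • ψ) = ‖c‖ ^ 2 * V.energy ψ :=
  integral_mul_norm_smul_sq V.W c ψ

theorem Potential.FormDomain.smul {V : Potential d N} {ψ : ParticleSpace d N}
    (h : V.FormDomain ψ) (c : ℂ) : V.FormDomain (c • ψ) :=
  ⟨h.1.smul c, (h.2.const_mul _).congr (ae_mul_norm_smul_sq V.W c ψ).symm⟩

theorem Potential.formDomain_smul_iff (V : Potential d N) {c : ℂ} (hc : c ≠ 0)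
    (ψ : ParticleSpace d N) : V.FormDomain (c • ψ) ↔ V.FormDomain ψ :=
  ⟨fun h => inv_smul_smul₀ hc ψ ▸ h.smul c⁻¹, fun h => h.smul c⟩

theorem integral_mul_re_conj_smul_mul_smul (f : Config d N → ℝ) (c : ℂ) (ψ φ : ParticleSpace d N) :
    ∫ X, f X * ((starRingEnd ℂ) ((c • ψ) X) * (c • φ) X).re =
      ‖c‖ ^ 2 * ∫ X, f X * ((starRingEnd ℂ) (ψ X) * φ X).re := by
  rw [← integral_const_mul]
  refine integral_congr_ae ?_
  filter_upwards [ae_smul_eq c ψ, ae_smul_eq c φ] with X hψ hφ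
  rw [hψ, hφ, map_mul, mul_mul_mul_comm, Complex.conj_mul', ← Complex.ofReal_pow,
    Complex.re_ofReal_mul, mul_left_comm]

theorem integral_norm_mul_smul_add_mul_smul_sq (f g : Config d N → ℂ) (c : ℂ)
    (ψ φ : ParticleSpace d N) :
    ∫ X, ‖f X * (c • φ) X + g X * (c • ψ) X‖ ^ 2 =
      ‖c‖ ^ 2 * ∫ X, ‖f X * φ X + g X * ψ X‖ ^ 2 := by
  rw [← integral_const_mul]
  refine integral_congr_ae ?_
  filter_upwards [ae_smul_eq c ψ, ae_smul_eq c φ] with X hψ hφ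
  rw [hψ, hφ, mul_left_comm, mul_left_comm (g X), ← mul_add, norm_mul, mul_pow]

theorem integrable_norm_sq (ψ : ParticleSpace d N) : Integrable fun X => ‖ψ X‖ ^ 2 :=
  (memLp_two_iff_integrable_sq_norm (Lp.aestronglyMeasurable ψ)).1 (Lp.memLp ψ)

theorem integrable_re_conj_mul (ψ φ : ParticleSpace d N) :
    Integrable fun X => ((starRingEnd ℂ) (ψ X) * φ X).re :=
  (L2.integrable_inner (𝕜 := ℂ) ψ φ).re.congr (ae_of_all _ fun X => by simp [mul_comm])

end Particles

section Pairing

variable {𝔥 : Type*} [NormedAddCommGroup 𝔥] [InnerProductSpace ℂ 𝔥] [CompleteSpace 𝔥]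
  {ω : Dispersion 𝔥}

theorem IsSqrt.symmetric {S : 𝔥 →ₗ.[ℂ] 𝔥} (hS : IsSqrt S ω) {u v u' v' : 𝔥}
    (h : (u, v) ∈ S.graph) (h' : (u', v') ∈ S.graph) : ⟪v, u'⟫_ℂ = ⟪u, v'⟫_ℂ := by
  have adjoint := LinearPMap.adjoint_isFormalAdjoint (T := S) hS.selfAdjoint.dense_domain
  rw [LinearPMap.isSelfAdjoint_def.1 hS.selfAdjoint] at adjoint
  obtain ⟨x, rfl, rfl⟩ := (LinearPMap.mem_graph_iff S).1 h
  obtain ⟨y, rfl, rfl⟩ := (LinearPMap.mem_graph_iff S).1 h'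
  exact adjoint x y

theorem IsSqrt.exists_mem_graph_norm_eq {S : 𝔥 →ₗ.[ℂ] 𝔥} (hS : IsSqrt S ω) (u : ω.Smooth) :
    ∃ v, ((ω.toDomain u : 𝔥), v) ∈ S.graph ∧ ‖v‖ = ‖u‖ := by
  obtain ⟨v, huv, hvw⟩ := (hS.sq _ _).1 (ω.op.mem_graph (ω.toDomain u))
  refine ⟨v, huv, (sq_eq_sq₀ (norm_nonneg _) (norm_nonneg _)).1 ?_⟩
  rw [← inner_self_eq_norm_sq (𝕜 := ℂ), hS.symmetric huv hvw]
  exact inner_self_eq_norm_sq (𝕜 := ℂ) u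

theorem IsSqrt.norm_inner_le {S : 𝔥 →ₗ.[ℂ] 𝔥} (hS : IsSqrt S ω) {f g : 𝔥}
    (hgf : (g, f) ∈ S.graph) (u : ω.Smooth) :
    ‖⟪f, (ω.toDomain u : 𝔥)⟫_ℂ‖ ≤ ‖g‖ * ‖u‖ := by
  obtain ⟨v, huv, v_norm⟩ := hS.exists_mem_graph_norm_eq u
  rw [hS.symmetric hgf huv, ← v_norm]
  exact norm_inner_le_norm g v

theorem IsSqrt.exists_inner_coe_eq {S : 𝔥 →ₗ.[ℂ] 𝔥} (hS : IsSqrt S ω) {f g : 𝔥}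
    (hgf : (g, f) ∈ S.graph) :
    ∃ η : ω.FieldSpace, ‖η‖ ≤ ‖g‖ ∧
      ∀ u : ω.Smooth, ⟪(u : ω.FieldSpace), η⟫_ℂ = ⟪(ω.toDomain u : 𝔥), f⟫_ℂ := by
  let ι : ω.Smooth →ₗ[ℂ] ω.FieldSpace := (UniformSpace.Completion.toComplL (𝕜 := ℂ)).toLinearMap
  have ι_dense : DenseRange ι := UniformSpace.Completion.denseRange_coe
  let T : ω.Smooth →ₗ[ℂ] ℂ := innerₛₗ ℂ f ∘ₗ ω.op.domain.subtype ∘ₗ ω.toDomain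
  have T_le (u : ω.Smooth) : ‖T u‖ ≤ ‖g‖ * ‖ι u‖ :=
    (hS.norm_inner_le hgf u).trans_eq (by rw [← UniformSpace.Completion.norm_coe u]; rfl)
  refine ⟨(InnerProductSpace.toDual ℂ _).symm (T.extendOfNorm ι), ?_, fun u => ?_⟩
  · rw [LinearIsometryEquiv.norm_map]
    exact LinearMap.opNorm_extendOfNorm_le ι_dense (norm_nonneg g) T_le
  · rw [← inner_conj_symm, InnerProductSpace.toDual_symm_apply, ← inner_conj_symm _ f]
    exact congrArg _ (LinearMap.extendOfNorm_eq ι_dense ⟨_, T_le⟩ u)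

theorem Dispersion.pairing_eq_inner {f : 𝔥} {η : ω.FieldSpace}
    (h : ∀ u : ω.Smooth, ⟪(u : ω.FieldSpace), η⟫_ℂ = ⟪(ω.toDomain u : 𝔥), f⟫_ℂ) (z : ω.FieldSpace) :
    ω.pairing z f = ⟪z, η⟫_ℂ := by
  have inner_uniformContinuous : UniformContinuous fun z : ω.FieldSpace => ⟪z, η⟫_ℂ :=
    ((innerSL ℂ).flip η).uniformContinuous
  refine congrFun (UniformSpace.Completion.extension_unique ?_ inner_uniformContinuous
    fun u => (h u).symm) z
  simp only [← h]
  exact inner_uniformContinuous.comp (UniformSpace.Completion.uniformContinuous_coe _)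

theorem InvSqrtBounded.exists_inner_coe_eq {d : ℕ} {f : Space d → 𝔥} (h : InvSqrtBounded ω f) :
    ∃ C : ℝ, ∀ᵐ x, ∃ η : ω.FieldSpace, ‖η‖ ≤ C ∧
      ∀ u : ω.Smooth, ⟪(u : ω.FieldSpace), η⟫_ℂ = ⟪(ω.toDomain u : 𝔥), f x⟫_ℂ := by
  obtain ⟨S, g, hS, hg, hgf⟩ := h
  refine ⟨(eLpNorm g ⊤ volume).toReal, ?_⟩
  filter_upwards [hgf, ae_le_eLpNormEssSup (f := g)] with x hx hgx
  obtain ⟨η, hη, inner_coe⟩ := hS.exists_inner_coe_eq hx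
  refine ⟨η, hη.trans ?_, inner_coe⟩
  rw [← toReal_enorm]
  exact ENNReal.toReal_mono hg.2.ne (hgx.trans_eq eLpNorm_exponent_top.symm)

theorem InvSqrtBounded.aestronglyMeasurable_pairing {d : ℕ} {f : Space d → 𝔥}
    (h : InvSqrtBounded ω f) (hf : AEStronglyMeasurable f volume) (z : ω.FieldSpace) :
    AEStronglyMeasurable (fun x => ω.pairing z (f x)) volume := by
  obtain ⟨C, hC⟩ := h.exists_inner_coe_eq
  obtain ⟨v, hv, v_tendsto⟩ := mem_closure_iff_seq_limit.1
    (UniformSpace.Completion.denseRange_coe (α := ω.Smooth) z)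
  choose u hu using hv
  have measurable_inner (n : ℕ) :
      AEStronglyMeasurable (fun x => ⟪(ω.toDomain (u n) : 𝔥), f x⟫_ℂ) volume :=
    aestronglyMeasurable_const.inner hf
  refine aestronglyMeasurable_of_tendsto_ae atTop measurable_inner ?_
  filter_upwards [hC] with x ⟨η, _, inner_coe⟩
  simp only [ω.pairing_eq_inner inner_coe, ← inner_coe, hu]
  exact Tendsto.inner v_tendsto tendsto_const_nhds

theorem InvSqrtBounded.isFormFactorPotential {d : ℕ} {f : Space d → 𝔥} (h : InvSqrtBounded ω f)
    (hf : AEStronglyMeasurable f volume) :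
    IsFormFactorPotential volume fun (z : ω.FieldSpace) x => (ω.pairing z (f x)).re where
  aestronglyMeasurable z :=
    Complex.continuous_re.comp_aestronglyMeasurable (h.aestronglyMeasurable_pairing hf z)
  exists_formFactor := by
    obtain ⟨C, hC⟩ := h.exists_inner_coe_eq
    exact ⟨C, hC.mono fun x ⟨η, hη, inner_coe⟩ =>
      ⟨η, hη, fun z => by rw [ω.pairing_eq_inner inner_coe]⟩⟩

end Pairing

section PlaneWave

variable {E : Type*} [NormedAddCommGroup E] [InnerProductSpace ℝ E]

/-- The plane wave `k ↦ K k e^{-ik·x}`, the form factor at `x` of the polaron potentials. -/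
def planeWave (K : E → ℝ) (x k : E) : ℂ := (K k : ℂ) * Complex.exp (-(Complex.I * (⟪k, x⟫_ℝ : ℂ)))

theorem norm_planeWave (K : E → ℝ) (x k : E) : ‖planeWave K x k‖ = ‖K k‖ := by
  simp [planeWave, Complex.norm_exp]

variable [MeasurableSpace E] [BorelSpace E] {μ ν : Measure E} {K : E → ℝ}

theorem memLp_planeWave (hK : MemLp K 2 μ) (x : E) : MemLp (planeWave K x) 2 μ := by
  have phase : Continuous fun k : E => Complex.exp (-(Complex.I * (⟪k, x⟫_ℝ : ℂ))) := by fun_prop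
  exact hK.congr_norm ((Complex.continuous_ofReal.comp_aestronglyMeasurable hK.1).mul
    phase.aestronglyMeasurable) (ae_of_all _ fun k => (norm_planeWave K x k).symm)

theorem inner_toLp_planeWave (hK : MemLp K 2 μ) (z : Lp ℂ 2 μ) (x : E) :
    ⟪z, (memLp_planeWave hK x).toLp⟫_ℂ = ∫ k, (starRingEnd ℂ) (z k) * planeWave K x k ∂μ := by
  rw [L2.inner_def]
  refine integral_congr_ae ?_
  filter_upwards [(memLp_planeWave hK x).coeFn_toLp] with k hk
  rw [hk, RCLike.inner_apply']

variable [SecondCountableTopology E]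

theorem aestronglyMeasurable_uncurry_planeWave (hK : AEStronglyMeasurable K μ) :
    AEStronglyMeasurable (fun p : E × E => planeWave K p.1 p.2) (ν.prod μ) := by
  have phase : Continuous fun p : E × E => Complex.exp (-(Complex.I * (⟪p.2, p.1⟫_ℝ : ℂ))) := by
    fun_prop
  exact (Complex.continuous_ofReal.comp_aestronglyMeasurable hK).comp_snd.mul
    phase.aestronglyMeasurable

variable [SFinite μ]

theorem isFormFactorPotential_planeWave (hK : MemLp K 2 μ) (c : ℂ) :
    IsFormFactorPotential ν fun (z : Lp ℂ 2 μ) x =>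
      (c * ∫ k, (starRingEnd ℂ) (z k) * planeWave K x k ∂μ).re where
  aestronglyMeasurable z := by
    have conj_z : AEStronglyMeasurable (fun k => (starRingEnd ℂ) (z k)) μ :=
      Complex.continuous_conj.comp_aestronglyMeasurable (Lp.aestronglyMeasurable z)
    exact Complex.continuous_re.comp_aestronglyMeasurable <| AEStronglyMeasurable.const_mul
      (conj_z.comp_snd.mul
        (aestronglyMeasurable_uncurry_planeWave hK.1)).integral_prod_right' c
  exists_formFactor := by
    refine ⟨‖c‖ * ‖hK.toLp‖, ae_of_all _ fun x =>
      ⟨c • (memLp_planeWave hK x).toLp, ?_, fun z => ?_⟩⟩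
    · rw [norm_smul, Lp.norm_toLp, Lp.norm_toLp,
        eLpNorm_congr_norm_ae (ae_of_all _ (norm_planeWave K x))]
    · rw [inner_smul_right, inner_toLp_planeWave hK]

theorem isFormFactorPotential_setIntegral_planeWave {s : Set E} (hs : MeasurableSet s)
    (hK : MemLp K 2 (μ.restrict s)) (c : ℂ) :
    IsFormFactorPotential ν fun (z : Lp ℂ 2 μ) x =>
      (c * ∫ k in s, (starRingEnd ℂ) (z k) * (K k : ℂ) *
        Complex.exp (-(Complex.I * (⟪k, x⟫_ℝ : ℂ))) ∂μ).re := by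
  have integral_eq (z : Lp ℂ 2 μ) (x : E) :
      ∫ k in s, (starRingEnd ℂ) (z k) * (K k : ℂ) * Complex.exp (-(Complex.I * (⟪k, x⟫_ℝ : ℂ))) ∂μ =
        ∫ k, (starRingEnd ℂ) (z k) * planeWave (s.indicator K) x k ∂μ := by
    rw [← integral_indicator hs]
    congr with k
    by_cases hk : k ∈ s <;> simp [planeWave, hk, mul_assoc]
  simpa only [integral_eq] using
    isFormFactorPotential_planeWave ((memLp_indicator_iff_restrict hs).2 hK) c

theorem memLp_two_norm_rpow {E : Type*} [NormedAddCommGroup E] [NormedSpace ℝ E]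
    [FiniteDimensional ℝ E] [Nontrivial E] [MeasurableSpace E] [BorelSpace E] (μ : Measure E)
    [μ.IsAddHaarMeasure] {p : ℝ} {I : Set ℝ} (hI : MeasurableSet I)
    (h : IntegrableOn (fun r : ℝ => r ^ (Module.finrank ℝ E - 1 + 2 * p)) (I ∩ Set.Ioi 0)) :
    MemLp (fun k : E => ‖k‖ ^ p) 2 (μ.restrict {k | ‖k‖ ∈ I}) := by
  have hs : MeasurableSet {k : E | ‖k‖ ∈ I} := measurable_norm hI
  rw [memLp_two_iff_integrable_sq (Measurable.aestronglyMeasurable (by fun_prop)), ← IntegrableOn,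
    ← integrable_indicator_iff hs]
  suffices Integrable (fun k : E => I.indicator (fun r => (r ^ p) ^ 2) ‖k‖) μ from this
  rw [integrable_fun_norm_addHaar, ← integrable_indicator_iff measurableSet_Ioi]
  rw [← integrable_indicator_iff (hI.inter measurableSet_Ioi)] at h
  refine h.congr (ae_of_all _ fun r => ?_)
  have rpow_eq (hr : 0 < r) : r ^ (Module.finrank ℝ E - 1 + 2 * p) =
      r ^ (Module.finrank ℝ E - 1) * (r ^ p) ^ 2 := by
    rw [Real.rpow_add hr, mul_comm 2 p, Real.rpow_mul hr.le, Real.rpow_two,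
      ← Nat.cast_pred Module.finrank_pos, Real.rpow_natCast]
  by_cases hrI : r ∈ I <;> by_cases hr : 0 < r <;> simp [hrI, hr, rpow_eq]

end PlaneWave

section Models

variable {𝔥 : Type*} [NormedAddCommGroup 𝔥] [InnerProductSpace ℂ 𝔥] [CompleteSpace 𝔥] {d N : ℕ}

theorem memLp_two_norm_rpow_low [NeZero d] (ϱ : ℝ) :
    MemLp (fun k : Space d => ‖k‖ ^ (-((d : ℝ) - 1) / 2)) 2 (volume.restrict {k | ‖k‖ ≤ ϱ}) := by
  refine memLp_two_norm_rpow volume (measurableSet_Iic (a := ϱ)) ?_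
  rw [finrank_euclideanSpace_fin, Set.inter_comm, Set.Ioi_inter_Iic]
  ring_nf
  simp only [Real.rpow_zero]
  exact integrableOn_const (by simp)

theorem memLp_two_norm_rpow_high [NeZero d] {ϱ : ℝ} (hϱ : 0 < ϱ) :
    MemLp (fun k : Space d => ‖k‖ ^ (-((d : ℝ) + 1) / 2)) 2 (volume.restrict {k | ϱ < ‖k‖}) := by
  refine memLp_two_norm_rpow volume (measurableSet_Ioi (a := ϱ)) ?_
  rw [finrank_euclideanSpace_fin]
  ring_nf
  exact (integrableOn_Ioi_rpow_of_lt (by norm_num) hϱ).mono_set Set.inter_subset_left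

theorem PolaronModel.isFormFactorPotential_lowPotential [NeZero d] (M : PolaronModel d N) :
    IsFormFactorPotential volume M.lowPotential := by
  have kernel := (memLp_two_norm_rpow_low (d := d) M.ϱ).const_mul (Real.sqrt M.α)
  have low := isFormFactorPotential_setIntegral_planeWave (ν := volume)
    (measurableSet_le measurable_norm measurable_const) kernel 1
  simp only [one_mul] at low
  exact low.const_mul 2

theorem PolaronModel.isFormFactorPotential_highField [NeZero d] (M : PolaronModel d N)
    (l : Fin d) : IsFormFactorPotential volume fun z x => M.highField z l x := by
  have kernel : MemLp (fun k : Space d =>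
      Real.sqrt M.α * ‖k‖ ^ (-((d : ℝ) + 1) / 2) * (k l / ‖k‖)) 2
      (volume.restrict {k | M.ϱ < ‖k‖}) := by
    refine ((memLp_two_norm_rpow_high (d := d) M.ϱ_pos).const_mul (Real.sqrt M.α)).mono
      (Measurable.aestronglyMeasurable (by fun_prop)) (ae_of_all _ fun k => ?_)
    rw [norm_mul _ (k l / ‖k‖), norm_div, norm_norm]
    exact mul_le_of_le_one_right (norm_nonneg _)
      (div_le_one_of_le₀ (PiLp.norm_apply_le k l) (norm_nonneg _))
  have high := isFormFactorPotential_setIntegral_planeWave (ν := volume)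
    (measurableSet_lt measurable_const measurable_norm) kernel Complex.I
  simp only [Complex.I_mul_re] at high
  convert high.const_mul 2 using 3
  simp only [PolaronModel.highField]
  ring

theorem NelsonModel.isQuadraticInField (M : NelsonModel 𝔥 d N) :
    IsQuadraticInField M.energy := by
  classical
  have potential (j : Fin N) : IsFormFactorPotential volume fun (z : M.ω.FieldSpace) X =>
      2 * (M.ω.pairing z (M.lam (position j X))).re :=
    ((M.invSqrt.isFormFactorPotential M.memLp.1).const_mul 2).comp
      (quasiMeasurePreserving_position j)
  refine isQuadraticInField_ite
    (F := fun ψ z => (∑ a, ‖weakGrad ψ a‖ ^ 2) + M.potential.energy ψ +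
      ∑ j, ∫ X, 2 * (M.ω.pairing z (M.lam (position j X))).re * ‖ψ X‖ ^ 2)
    (fun c ψ hc => M.potential.formDomain_smul_iff hc ψ) (fun c ψ z hψ => ?_) (fun ψ _ => ?_)
  · simp only [hψ.1.sum_norm_weakGrad_smul_sq, M.potential.energy_smul, integral_mul_norm_smul_sq,
      ← Finset.mul_sum, mul_add]
  · exact (IsConvexQuadratic.const _).add <| .sum _ fun j =>
      (potential j).isConvexQuadratic_integral (integrable_norm_sq ψ)

theorem PolaronModel.isQuadraticInField [NeZero d] (M : PolaronModel d N) :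
    IsQuadraticInField M.energy := by
  classical
  refine isQuadraticInField_ite
    (F := fun ψ z => (∑ a, ‖weakGrad ψ a‖ ^ 2) + M.potential.energy ψ +
      ∑ j, ((∫ X, M.lowPotential z (position j X) * ‖ψ X‖ ^ 2) -
        2 * ∑ l, ∫ X, M.highField z l (position j X) *
          ((starRingEnd ℂ) (ψ X) * weakGrad ψ (j, l) X).re))
    (fun c ψ hc => M.potential.formDomain_smul_iff hc ψ) (fun c ψ z hψ => ?_) (fun ψ _ => ?_)
  · simp only [hψ.1.sum_norm_weakGrad_smul_sq]
    simp only [hψ.1.weakGrad_smul, M.potential.energy_smul, integral_mul_norm_smul_sq,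
      Pi.smul_apply, integral_mul_re_conj_smul_mul_smul, ← Finset.mul_sum, mul_add,
      mul_left_comm (2 : ℝ), ← mul_sub]
  · have low (j : Fin N) : IsConvexQuadratic fun z =>
        ∫ X, M.lowPotential z (position j X) * ‖ψ X‖ ^ 2 :=
      (M.isFormFactorPotential_lowPotential.comp
        (quasiMeasurePreserving_position j)).isConvexQuadratic_integral (integrable_norm_sq ψ)
    have high (j : Fin N) (l : Fin d) : IsConvexQuadratic fun z =>
        ∫ X, -2 * M.highField z l (position j X) *
          ((starRingEnd ℂ) (ψ X) * weakGrad ψ (j, l) X).re :=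
      (((M.isFormFactorPotential_highField l).comp
        (quasiMeasurePreserving_position j)).const_mul (-2)).isConvexQuadratic_integral
        (integrable_re_conj_mul _ _)
    simp only [sub_eq_add_neg, ← neg_mul]
    simp only [Finset.mul_sum, ← integral_const_mul, ← mul_assoc]
    exact (IsConvexQuadratic.const _).add <| .sum _ fun j =>
      (low j).add <| .sum _ fun l => high j l

theorem PauliFierzModel.isQuadraticInField (M : PauliFierzModel 𝔥 N) :
    IsQuadraticInField M.energy := by
  classical
  have potential (j : Fin N) (l : Fin 3) : IsFormFactorPotential volume
      fun (z : M.ω.FieldSpace) X => M.e * M.vectorPotential z j l (position j X) :=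
    ((((M.invSqrt j l).isFormFactorPotential (M.memLp j l).1).const_mul 2).comp
      (quasiMeasurePreserving_position j)).const_mul M.e
  refine isQuadraticInField_ite
    (F := fun ψ z => (∑ j, (1 / (2 * M.mass j)) * ∑ l, ∫ X, ‖-Complex.I * weakGrad ψ (j, l) X +
      ((M.e * M.vectorPotential z j l (position j X) : ℝ) : ℂ) * ψ X‖ ^ 2) + M.potential.energy ψ)
    (fun c ψ hc => M.potential.formDomain_smul_iff hc ψ) (fun c ψ z hψ => ?_) (fun ψ _ => ?_)
  · simp only [hψ.1.weakGrad_smul, Pi.smul_apply, integral_norm_mul_smul_add_mul_smul_sq,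
      M.potential.energy_smul, ← Finset.mul_sum, mul_left_comm _ (‖c‖ ^ 2), mul_add]
  · have kinetic (j : Fin N) (l : Fin 3) : IsConvexQuadratic fun z =>
        ∫ X, ‖-Complex.I * weakGrad ψ (j, l) X +
          ((M.e * M.vectorPotential z j l (position j X) : ℝ) : ℂ) * ψ X‖ ^ 2 := by
      simp only [← Complex.real_smul (x := M.e * _)]
      exact (potential j l).isConvexQuadratic_integral_norm_add_sq
        ((Lp.memLp (weakGrad ψ (j, l))).const_mul (-Complex.I)) (Lp.memLp ψ)
    have mass_nonneg (j : Fin N) : 0 ≤ 1 / (2 * M.mass j) := by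
      have mass_pos := M.mass_pos j
      positivity
    exact (IsConvexQuadratic.sum _ fun j =>
      (IsConvexQuadratic.sum _ fun l => kinetic j l).const_mul (mass_nonneg j)).add (.const _)

end Models

end QuasiClassical

end

theorem mainTheorem9_general (d N : ℕ) (hd : 1 ≤ d) (hN : 1 ≤ N) :
    (∀ (𝔥 : Type*) [NormedAddCommGroup 𝔥] [InnerProductSpace ℂ 𝔥] [CompleteSpace 𝔥]
      (M : QuasiClassical.NelsonModel 𝔥 d N), QuasiClassical.EnergiesCoincide M.energy) ∧
    (∀ M : QuasiClassical.PolaronModel d N, QuasiClassical.EnergiesCoincide M.energy) ∧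
    (∀ (𝔥 : Type*) [NormedAddCommGroup 𝔥] [InnerProductSpace ℂ 𝔥] [CompleteSpace 𝔥]
      (M : QuasiClassical.PauliFierzModel 𝔥 N), QuasiClassical.EnergiesCoincide M.energy) := by
  have : NeZero d := ⟨Nat.one_le_iff_ne_zero.1 hd⟩
  have infinite_dim := QuasiClassical.not_finiteDimensional_particleSpace hd hN
  have infinite_dim_three :=
    QuasiClassical.not_finiteDimensional_particleSpace (d := 3) (by norm_num) hN
  exact ⟨fun 𝔥 _ _ _ M => M.isQuadraticInField.energiesCoincide infinite_dim,
    fun M => M.isQuadraticInField.energiesCoincide infinite_dim,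
    fun 𝔥 _ _ _ M => M.isQuadraticInField.energiesCoincide infinite_dim_three⟩

theorem mainTheorem9 (d N : ℕ) (hd : 1 ≤ d) (hd' : d ≤ 3) (hN : 1 ≤ N) :
    (∀ (𝔥 : Type*) [NormedAddCommGroup 𝔥] [InnerProductSpace ℂ 𝔥] [CompleteSpace 𝔥]
      [TopologicalSpace.SeparableSpace 𝔥] (M : QuasiClassical.NelsonModel 𝔥 d N),
      QuasiClassical.EnergiesCoincide M.energy) ∧
    (∀ M : QuasiClassical.PolaronModel d N, QuasiClassical.EnergiesCoincide M.energy) ∧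
    (∀ (𝔥 : Type*) [NormedAddCommGroup 𝔥] [InnerProductSpace ℂ 𝔥] [CompleteSpace 𝔥]
      [TopologicalSpace.SeparableSpace 𝔥] (M : QuasiClassical.PauliFierzModel 𝔥 N),
      QuasiClassical.EnergiesCoincide M.energy) := by
  obtain ⟨nelson, polaron, pauliFierz⟩ := mainTheorem9_general d N hd hN
  exact ⟨fun 𝔥 _ _ _ _ => nelson 𝔥, polaron, fun 𝔥 _ _ _ _ => pauliFierz 𝔥⟩
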